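/- Let $J>0$, $h>0$, $\zeta\in(0,\pi)$, and put $\eta=-\mathrm i\zeta$. For $T>0$ let $\aleph=\frac JT\sinh\eta$, and let $$R(\lambda)=\frac1{\sinh\eta}\begin{pmatrix}\sinh(\eta+\lambda)&0&0&0\\0&\sinh\lambda&\sinh\eta&0\\0&\sinh\eta&\sinh\lambda&0\\0&0&0&\sinh(\eta+\lambda)\end{pmatrix}$$ be the six-vertex $R$-matrix on $\mathbb C^2\otimes\mathbb C^2$. For an integer $N\ge1$ let $\mathfrak h_0,\mathfrak h_1,\dots,\mathfrak h_{2N}$ be copies of $\mathbb C^2$; write $R_{ab}$ for the operator on $\mathfrak h_0\otimes\mathfrak h_1\otimes\cdots\otimes\mathfrak h_{2N}$ that acts as $R$ on $\mathfrak h_a\otimes\mathfrak h_b$ and as the identity on the other factors, $\mathfrak t_a$ for the partial transposition on $\mathfrak h_a$, and $\sigma^z_0$ for the Pauli matrix $\sigma^z$ acting on $\mathfrak h_0$. The quantum transfer matrix is the operator on $\mathfrak h_1\otimes\cdots\otimes\mathfrak h_{2N}$ $$\mathsf t_{\mathfrak q}=\operatorname{tr}_{\mathfrak h_0}\Big[R_{2N,0}^{\mathfrak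 t_{2N}}\big(-\tfrac{\aleph}N\big)\,R_{0,2N-1}\big(-\tfrac{\aleph}N\big)\cdots R_{2,0}^{\mathfrak t_2}\big(-\tfrac{\aleph}N\big)\,R_{0,1}\big(-\tfrac{\aleph}N\big)\,e^{\frac h{2T}\sigma^z_0}\Big].$$ Theorem. There exists $T_0>0$ (depending on $J,h,\zeta$) such that for every $T\ge T_0$ the following holds. The trace $\operatorname{tr}[\mathsf t_{\mathfrak q}^L]$ is real and positive for all integers $N,L\ge1$; all the limits below exist and are finite (the inner ones for every $L\ge1$, respectively every $N\ge1$); and $$\lim_{L\to\infty}\lim_{N\to\infty}\frac1L\ln\operatorname{tr}\big[\mathsf t_{\mathfrak q}^L\big]=\lim_{N\to\infty}\lim_{L\to\infty}\frac1L\ln\operatorname{tr}\big[\mathsf t_{\mathfrak q}^L\big].$$ -/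

import Mathlib

open Filter Topology

noncomputable section

namespace XXZ

/-- The parameter `η = -iζ`, so that the anisotropy is `Δ = cosh η = cos ζ`. -/
def eta (ζ : ℝ) : ℂ := -Complex.I * (ζ : ℂ)

/-- The constant `ℵ = (J / T) sinh η`. -/
def aleph (J ζ T : ℝ) : ℂ := ((J : ℂ) / (T : ℂ)) * Complex.sinh (eta ζ)

/-- The six-vertex `R`-matrix, as an endomorphism of `ℂ² ⊗ ℂ²`, in the basis `e_i ⊗ e_j`
indexed by `(i, j)` (spin up is `0`, spin down is `1`). In the ordering
`(0,0), (0,1), (1,0), (1,1)` it is `(sinh η)⁻¹` times the matrix with rows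
`(sinh (η + lam), 0, 0, 0)`, `(0, sinh lam, sinh η, 0)`, `(0, sinh η, sinh lam, 0)`,
`(0, 0, 0, sinh (η + lam))`. -/
def rMatrix (η lam : ℂ) : Matrix (Fin 2 × Fin 2) (Fin 2 × Fin 2) ℂ :=
  (Complex.sinh η)⁻¹ • Matrix.of fun p q : Fin 2 × Fin 2 =>
    if p = q then (if p.1 = p.2 then Complex.sinh (η + lam) else Complex.sinh lam)
    else if p = q.swap then Complex.sinh η else 0

/-- Partial transposition with respect to the first tensor factor of `ℂ² ⊗ ℂ²`. -/
def transposeFst (M : Matrix (Fin 2 × Fin 2) (Fin 2 × Fin 2) ℂ) :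
    Matrix (Fin 2 × Fin 2) (Fin 2 × Fin 2) ℂ :=
  Matrix.of fun p q => M (q.1, p.2) (p.1, q.2)

/-- For distinct sites `a ≠ b`, the embedding of an operator on `ℂ² ⊗ ℂ²` into the operators on
the tensor product `⨂_{k < m} ℂ²`: it acts as `M` on `h_a ⊗ h_b` (first factor at `a`, second
factor at `b`) and as the identity on all other factors. The space `⨂_{k < m} ℂ²` has the
canonical basis `e_{s 0} ⊗ ⋯ ⊗ e_{s (m-1)}`, indexed by `s : Fin m → Fin 2`. -/
def embedTwo {m : ℕ} (a b : Fin m) (M : Matrix (Fin 2 × Fin 2) (Fin 2 × Fin 2) ℂ) :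
    Matrix (Fin m → Fin 2) (Fin m → Fin 2) ℂ :=
  Matrix.of fun s t =>
    if ∀ k, k ≠ a → k ≠ b → s k = t k then M (s a, s b) (t a, t b) else 0

/-- The embedding of an operator on `ℂ²` into the operators on `⨂_{k < m} ℂ²`, acting
nontrivially only at the site `a`. -/
def embedOne {m : ℕ} (a : Fin m) (M : Matrix (Fin 2) (Fin 2) ℂ) :
    Matrix (Fin m → Fin 2) (Fin m → Fin 2) ℂ :=
  Matrix.of fun s t => if ∀ k, k ≠ a → s k = t k then M (s a) (t a) else 0

/-- The `2 × 2` matrix `exp (c σ^z)`, where `σ^z = diag (1, -1)`. -/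
def expSigmaZ (c : ℝ) : Matrix (Fin 2) (Fin 2) ℂ :=
  Matrix.diagonal ![Complex.exp (c : ℂ), Complex.exp (-(c : ℂ))]

/-- The quantum monodromy matrix on `h_0 ⊗ h_1 ⊗ ⋯ ⊗ h_{2N}`, where site `0` is the auxiliary
space:
`R_{2N,0}^{t_{2N}}(-ℵ/N - ξ) R_{0,2N-1}(ξ - ℵ/N) ⋯ R_{2,0}^{t_2}(-ℵ/N - ξ) R_{0,1}(ξ - ℵ/N)
exp ((h / 2T) σ^z_0)`.
The factor of index `l : Fin N` in the product below is the one on the sites `2l + 2`, `2l + 1`;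
`l` decreases from left to right. -/
def monodromy (J h ζ T : ℝ) (N : ℕ) (ξ : ℂ) :
    Matrix (Fin (2 * N + 1) → Fin 2) (Fin (2 * N + 1) → Fin 2) ℂ :=
  ((List.finRange N).reverse.map fun l =>
      embedTwo (⟨2 * l.1 + 2, by omega⟩ : Fin (2 * N + 1)) ⟨0, by omega⟩
          (transposeFst (rMatrix (eta ζ) (-(aleph J ζ T / (N : ℂ)) - ξ))) *
        embedTwo (⟨0, by omega⟩ : Fin (2 * N + 1)) ⟨2 * l.1 + 1, by omega⟩
          (rMatrix (eta ζ) (ξ - aleph J ζ T / (N : ℂ)))).prod *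
    embedOne (⟨0, by omega⟩ : Fin (2 * N + 1)) (expSigmaZ (h / (2 * T)))

/-- The partial trace over site `0`. -/
def traceAux {m : ℕ} (M : Matrix (Fin (m + 1) → Fin 2) (Fin (m + 1) → Fin 2) ℂ) :
    Matrix (Fin m → Fin 2) (Fin m → Fin 2) ℂ :=
  Matrix.of fun s t =>
    ∑ i : Fin 2, M (Fin.cons (α := fun _ => Fin 2) i s) (Fin.cons (α := fun _ => Fin 2) i t)

/-- The quantum transfer matrix with Trotter number `N`, acting on `(ℂ²)^{⊗ 2N}`. -/
def quantumTransferMatrix (J h ζ T : ℝ) (N : ℕ) :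
    Matrix (Fin (2 * N) → Fin 2) (Fin (2 * N) → Fin 2) ℂ :=
  traceAux (monodromy J h ζ T N 0)

/-- The trace of the `L`-th power of the quantum transfer matrix. -/
def tracePow (J h ζ T : ℝ) (N L : ℕ) : ℂ :=
  (quantumTransferMatrix J h ζ T N ^ L).trace

/-- `(1 / L) ln tr [t_q ^ L]`, with the principal branch of the logarithm. -/
def tau (J h ζ T : ℝ) (N L : ℕ) : ℂ :=
  (1 / (L : ℂ)) * Complex.log (tracePow J h ζ T N L)

end XXZ

end

/-! The trace of `t_q ^ L` is a six-vertex partition function on a torus with `L` columns and `2N`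
lines. Evaluating it along the other direction (`trace_pow_eq_trace_columns`, `tracePow_eq`) gives
`tr ((Aᵀ A) ^ N D)`. Here `A` is the row-to-row transfer matrix on a periodic chain of `L` sites and
`D` is the positive product weight of the magnetic field, which `A` conserves. At the spectral
parameter `-ℵ/N` the braided vertex weights are real, symmetric and within `4 J / (T N)` of the
identity.

The point is a comparison uniform in both `N` and `L`. Write `A` as the cyclic shift times the
ordered product of gates on an open chain (the staircase), up to the one vertex that closes the
chain. Cutting the open chain likewise removes a single gate. Deleting one gate is harmless: a local
operator on the first site can be pulled through the whole staircase with norm at most `2`, whatever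
the length (`Transports.step`). Each deletion is therefore left multiplication by `1 + Y` with `‖Y‖
= O(J / (T N))`. A pointwise bound `‖A v‖² ≤ c ‖B v‖²` passes to the weighted traces with factor `c
^ N` (`trace_pow_mul_diagonal_le`), and `(1 + O(J / (T N))) ^ (2N)` stays bounded by `exp (128 J /
T)`.

Hence the logarithm of the partition function is additive in `L` up to a constant independent of `N`
and `L` (`periodicPartition_mul`). Its averages converge in `L` at a rate `K / L` uniform in `N`.
Together with the Trotter limit at fixed `L` (`exists_tendsto_periodicPartition`), this allows the
limits to be exchanged (`exists_tendsto_of_quasiAdditive`). -/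

set_option linter.unusedSectionVars false

namespace XXZ

open Matrix Finset
open scoped Kronecker Matrix.Norms.L2Operator

/-! ### Operator norm estimates for real matrices -/

section Norms

variable {n m : Type*} [Fintype n] [DecidableEq n] [Fintype m] [DecidableEq m]

theorem sum_sq_mulVec_le (A : Matrix n n ℝ) (v : n → ℝ) :
    ∑ i, (A *ᵥ v) i ^ 2 ≤ ‖A‖ ^ 2 * ∑ i, v i ^ 2 := by
  have h := l2_opNorm_mulVec A (WithLp.toLp 2 v)
  have h2 := mul_self_le_mul_self (norm_nonneg _) h
  rw [← pow_two, ← pow_two, mul_pow, EuclideanSpace.real_norm_sq_eq,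
    EuclideanSpace.real_norm_sq_eq] at h2
  exact h2

theorem l2_opNorm_le_of_sum_sq (A : Matrix n n ℝ) {c : ℝ} (hc : 0 ≤ c)
    (h : ∀ v : n → ℝ, ∑ i, (A *ᵥ v) i ^ 2 ≤ c ^ 2 * ∑ i, v i ^ 2) : ‖A‖ ≤ c := by
  rw [cstar_norm_def]
  refine ContinuousLinearMap.opNorm_le_bound _ hc fun v => ?_
  refine le_of_sq_le_sq ?_ (by positivity)
  rw [mul_pow, EuclideanSpace.real_norm_sq_eq, EuclideanSpace.real_norm_sq_eq]
  exact h v.ofLp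

theorem norm_kronecker_one_le (A : Matrix n n ℝ) : ‖A ⊗ₖ (1 : Matrix m m ℝ)‖ ≤ ‖A‖ := by
  refine l2_opNorm_le_of_sum_sq _ (norm_nonneg _) fun v => ?_
  have key : ∀ i j, ((A ⊗ₖ (1 : Matrix m m ℝ)) *ᵥ v) (i, j) = (A *ᵥ fun k => v (k, j)) i := by
    intro i j
    simp [mulVec, dotProduct, Fintype.sum_prod_type, one_apply]
  rw [Fintype.sum_prod_type_right, Fintype.sum_prod_type_right, Finset.mul_sum]
  simp only [key]
  exact Finset.sum_le_sum fun j _ => sum_sq_mulVec_le A _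

theorem norm_one_kronecker_le (B : Matrix m m ℝ) : ‖(1 : Matrix n n ℝ) ⊗ₖ B‖ ≤ ‖B‖ := by
  refine l2_opNorm_le_of_sum_sq _ (norm_nonneg _) fun v => ?_
  have key : ∀ i j, (((1 : Matrix n n ℝ) ⊗ₖ B) *ᵥ v) (i, j) = (B *ᵥ fun k => v (i, k)) j := by
    intro i j
    simp [mulVec, dotProduct, Fintype.sum_prod_type, one_apply]
  rw [Fintype.sum_prod_type, Fintype.sum_prod_type, Finset.mul_sum]
  simp only [key]
  exact Finset.sum_le_sum fun j _ => sum_sq_mulVec_le B _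

theorem norm_kronecker_le (A : Matrix n n ℝ) (B : Matrix m m ℝ) : ‖A ⊗ₖ B‖ ≤ ‖A‖ * ‖B‖ := by
  have : A ⊗ₖ B = (A ⊗ₖ (1 : Matrix m m ℝ)) * ((1 : Matrix n n ℝ) ⊗ₖ B) := by
    rw [← mul_kronecker_mul, mul_one, one_mul]
  rw [this]
  exact (norm_mul_le _ _).trans (mul_le_mul (norm_kronecker_one_le A) (norm_one_kronecker_le B)
    (norm_nonneg _) (norm_nonneg _))

theorem norm_single_le (i j : n) (c : ℝ) : ‖Matrix.single i j c‖ ≤ |c| := by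
  refine l2_opNorm_le_of_sum_sq _ (abs_nonneg _) fun v => ?_
  have : ∀ k, (Matrix.single i j c *ᵥ v) k ^ 2 = if k = i then c ^ 2 * v j ^ 2 else 0 := by
    intro k
    rw [single_mulVec]
    by_cases h : k = i
    · subst h; simp [mul_pow]
    · simp [h]
  simp only [this, Finset.sum_ite_eq', Finset.mem_univ, if_true, sq_abs]
  exact mul_le_mul_of_nonneg_left
    (Finset.single_le_sum (f := fun i => v i ^ 2) (fun i _ => sq_nonneg _) (Finset.mem_univ j))
    (sq_nonneg _)

theorem norm_le_sum_abs (A : Matrix n n ℝ) : ‖A‖ ≤ ∑ i, ∑ j, |A i j| := by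
  conv_lhs => rw [matrix_eq_sum_single A]
  exact (norm_sum_le _ _).trans (Finset.sum_le_sum fun i _ =>
    (norm_sum_le _ _).trans (Finset.sum_le_sum fun j _ => norm_single_le _ _ _))

theorem sum_sq_mulVec_of_transpose_mul_self {U : Matrix n n ℝ} (hU : Uᵀ * U = 1) (v : n → ℝ) :
    ∑ i, (U *ᵥ v) i ^ 2 = ∑ i, v i ^ 2 := by
  have h : (U *ᵥ v) ⬝ᵥ (U *ᵥ v) = v ⬝ᵥ v := by
    rw [dotProduct_mulVec, vecMul_mulVec, hU, ← dotProduct_mulVec, one_mulVec]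
  simpa [dotProduct, pow_two] using h

theorem norm_le_one_of_transpose_mul_self {U : Matrix n n ℝ} (hU : Uᵀ * U = 1) : ‖U‖ ≤ 1 :=
  l2_opNorm_le_of_sum_sq _ zero_le_one fun v => by
    rw [sum_sq_mulVec_of_transpose_mul_self hU]; simp

theorem norm_mulVec_one_add_le {Y : Matrix n n ℝ} {κ : ℝ} (hY : ‖Y‖ ≤ κ) (v : n → ℝ) :
    ∑ i, ((1 + Y) *ᵥ v) i ^ 2 ≤ (1 + κ) ^ 2 * ∑ i, v i ^ 2 := by
  have hκ := (norm_nonneg Y).trans hY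
  refine (sum_sq_mulVec_le _ v).trans ?_
  gcongr
  refine (norm_add_le _ _).trans ?_
  have : ‖(1 : Matrix n n ℝ)‖ ≤ 1 := norm_le_one_of_transpose_mul_self (by simp)
  linarith

/-- The triangle inequality gives the factor `1 / (1 - κ)`, which is at most `1 + 2κ` for `κ ≤ 1/2`.
This makes the later comparisons two-sided. -/
theorem le_norm_mulVec_one_add {Y : Matrix n n ℝ} {κ : ℝ} (hY : ‖Y‖ ≤ κ) (hκ1 : κ ≤ 1 / 2)
    (v : n → ℝ) :
    ∑ i, v i ^ 2 ≤ (1 + 2 * κ) ^ 2 * ∑ i, ((1 + Y) *ᵥ v) i ^ 2 := by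
  have hκ := (norm_nonneg Y).trans hY
  have h1 : ‖WithLp.toLp 2 v‖ - κ * ‖WithLp.toLp 2 v‖ ≤ ‖WithLp.toLp 2 ((1 + Y) *ᵥ v)‖ := by
    have h2 := l2_opNorm_mulVec Y (WithLp.toLp 2 v)
    have h3 : ‖WithLp.toLp 2 v‖ ≤ ‖WithLp.toLp 2 ((1 + Y) *ᵥ v)‖ + ‖WithLp.toLp 2 (Y *ᵥ v)‖ := by
      have : WithLp.toLp 2 v = WithLp.toLp 2 ((1 + Y) *ᵥ v) - WithLp.toLp 2 (Y *ᵥ v) := by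
        rw [add_mulVec, one_mulVec]; ext i; simp
      conv_lhs => rw [this]
      exact norm_sub_le _ _
    have h4 := mul_le_mul_of_nonneg_right hY (norm_nonneg (WithLp.toLp 2 v))
    have h5 : ‖WithLp.toLp 2 (Y *ᵥ v)‖ ≤ ‖Y‖ * ‖WithLp.toLp 2 v‖ := h2
    linarith
  have h6 : ‖WithLp.toLp 2 v‖ ≤ (1 + 2 * κ) * ‖WithLp.toLp 2 ((1 + Y) *ᵥ v)‖ := by
    have h7 : ‖WithLp.toLp 2 v‖ ≤ (1 + 2 * κ) * (‖WithLp.toLp 2 v‖ - κ * ‖WithLp.toLp 2 v‖) := by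
      have : 0 ≤ κ * (1 - 2 * κ) * ‖WithLp.toLp 2 v‖ :=
        mul_nonneg (mul_nonneg hκ (by linarith)) (norm_nonneg _)
      linarith
    exact h7.trans (mul_le_mul_of_nonneg_left h1 (by linarith))
  have h8 := pow_le_pow_left₀ (norm_nonneg _) h6 2
  rw [mul_pow, EuclideanSpace.real_norm_sq_eq, EuclideanSpace.real_norm_sq_eq] at h8
  exact h8

end Norms

end XXZ

namespace XXZ

open Matrix Finset
open scoped Kronecker Matrix.Norms.L2Operator

/-! ### Monotonicity of traces of powers, with a conserved weight -/

section TraceMonotone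

variable {n : Type*} [Fintype n] [DecidableEq n]

theorem exists_orthogonal_diagonal {K : Matrix n n ℝ} (hK : K.IsHermitian) :
    ∃ (P : Matrix n n ℝ) (μ : n → ℝ), Pᵀ * P = 1 ∧ P * Pᵀ = 1 ∧ K = P * diagonal μ * Pᵀ := by
  refine ⟨(hK.eigenvectorUnitary : Matrix n n ℝ), hK.eigenvalues, ?_, ?_, ?_⟩
  · have := Unitary.coe_star_mul_self hK.eigenvectorUnitary
    rwa [star_eq_conjTranspose, conjTranspose_eq_transpose_of_trivial] at this
  · have := Unitary.coe_mul_star_self hK.eigenvectorUnitary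
    rwa [Unitary.coe_star, star_eq_conjTranspose, conjTranspose_eq_transpose_of_trivial] at this
  · have := hK.spectral_theorem
    rw [Unitary.conjStarAlgAut_apply, star_eq_conjTranspose,
      conjTranspose_eq_transpose_of_trivial] at this
    exact this

theorem conj_diagonal_pow {P : Matrix n n ℝ} (h : Pᵀ * P = 1) (μ : n → ℝ) (N : ℕ) :
    (P * diagonal μ * Pᵀ) ^ N * P = P * diagonal (fun i => μ i ^ N) := by
  induction N with
  | zero => simp
  | succ N ih =>
    rw [pow_succ', mul_assoc, ih]
    simp only [mul_assoc]
    rw [← mul_assoc Pᵀ, h, one_mul, diagonal_mul_diagonal]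
    simp [pow_succ']

theorem trace_conj_diagonal_pow {P : Matrix n n ℝ} (h : Pᵀ * P = 1) (h' : P * Pᵀ = 1) (μ : n → ℝ)
    (N : ℕ) : ((P * diagonal μ * Pᵀ) ^ N).trace = ∑ i, μ i ^ N := by
  have := conj_diagonal_pow h μ N
  have h2 : (P * diagonal μ * Pᵀ) ^ N = P * diagonal (fun i => μ i ^ N) * Pᵀ := by
    rw [← this, mul_assoc _ P, h', mul_one]
  rw [h2, trace_mul_comm, ← mul_assoc, h, one_mul, trace_diagonal]

theorem quadratic_transpose_mul_self (A P : Matrix n n ℝ) (i : n) :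
    (Pᵀ * (Aᵀ * A) * P) i i = ∑ k, (A *ᵥ (fun l => P l i)) k ^ 2 := by
  have : Pᵀ * (Aᵀ * A) * P = (A * P)ᵀ * (A * P) := by
    rw [transpose_mul]; simp only [mul_assoc]
  rw [this, mul_apply]
  refine Finset.sum_congr rfl fun k _ => ?_
  rw [transpose_apply, pow_two]
  rfl

/-- Although `t ↦ t ^ N` is not operator monotone, its trace is monotone. Each eigenvalue of `Aᵀ A`
is at most `c` times an average of the eigenvalues of `Bᵀ B`, weighted by the squared overlaps of
the two eigenbases. These overlaps form a doubly stochastic matrix, so Jensen's inequality for `t ^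
N` followed by summation gives the claim. -/
theorem trace_pow_transpose_mul_self_le (A B : Matrix n n ℝ) {c : ℝ} (hc : 0 ≤ c)
    (h : ∀ v : n → ℝ, ∑ i, (A *ᵥ v) i ^ 2 ≤ c * ∑ i, (B *ᵥ v) i ^ 2) (N : ℕ) :
    ((Aᵀ * A) ^ N).trace ≤ c ^ N * ((Bᵀ * B) ^ N).trace := by
  obtain ⟨P, lam, hP, hP', hA⟩ := exists_orthogonal_diagonal
    (K := Aᵀ * A) (by simpa using isHermitian_conjTranspose_mul_self A)
  obtain ⟨Q, μ, hQ, hQ', hB⟩ := exists_orthogonal_diagonal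
    (K := Bᵀ * B) (by simpa using isHermitian_conjTranspose_mul_self B)
  have hlam : ∀ i, lam i = ∑ k, (A *ᵥ (fun l => P l i)) k ^ 2 := by
    intro i
    rw [← quadratic_transpose_mul_self, hA]
    simp only [mul_assoc, hP, mul_one]
    rw [← mul_assoc, hP, one_mul, diagonal_apply_eq]
  have hμ : ∀ i, 0 ≤ μ i := by
    intro i
    have : μ i = ∑ k, (B *ᵥ (fun l => Q l i)) k ^ 2 := by
      rw [← quadratic_transpose_mul_self, hB]
      simp only [mul_assoc, hQ, mul_one]
      rw [← mul_assoc, hQ, one_mul, diagonal_apply_eq]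
    rw [this]
    exact Finset.sum_nonneg fun _ _ => sq_nonneg _
  set O := Qᵀ * P with hO
  have hOO : Oᵀ * O = 1 := by
    rw [hO, transpose_mul, transpose_transpose, mul_assoc, ← mul_assoc Q, hQ', one_mul, hP]
  have hOO' : O * Oᵀ = 1 := by
    rw [hO, transpose_mul, transpose_transpose, mul_assoc, ← mul_assoc P, hP', one_mul, hQ]
  have hcol : ∀ i, ∑ j, O j i ^ 2 = 1 := by
    intro i
    have := congrFun (congrFun hOO i) i
    rw [mul_apply, one_apply_eq] at this
    simpa [pow_two] using this
  have hrow : ∀ j, ∑ i, O j i ^ 2 = 1 := by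
    intro j
    have := congrFun (congrFun hOO' j) j
    rw [mul_apply, one_apply_eq] at this
    simpa [pow_two] using this
  have hBP : ∀ i, ∑ k, (B *ᵥ (fun l => P l i)) k ^ 2 = ∑ j, O j i ^ 2 * μ j := by
    intro i
    rw [← quadratic_transpose_mul_self, hB]
    have : Pᵀ * (Q * diagonal μ * Qᵀ) * P = Oᵀ * (diagonal μ * O) := by
      rw [hO, transpose_mul, transpose_transpose]; simp only [mul_assoc]
    rw [this, mul_apply]
    refine Finset.sum_congr rfl fun j _ => ?_
    rw [diagonal_mul, transpose_apply]
    ring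
  have hle : ∀ i, lam i ^ N ≤ c ^ N * ∑ j, O j i ^ 2 * μ j ^ N := by
    intro i
    have h1 : lam i ≤ c * ∑ j, O j i ^ 2 * μ j := by
      rw [hlam, ← hBP]; exact h _
    have h0 : 0 ≤ lam i := by
      rw [hlam]; exact Finset.sum_nonneg fun _ _ => sq_nonneg _
    refine (pow_le_pow_left₀ h0 h1 N).trans ?_
    rw [mul_pow]
    refine mul_le_mul_of_nonneg_left ?_ (pow_nonneg hc N)
    exact Real.pow_arith_mean_le_arith_mean_pow _ _ _ (fun j _ => sq_nonneg _) (hcol i)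
      (fun j _ => hμ j) N
  rw [hA, hB, trace_conj_diagonal_pow hP hP', trace_conj_diagonal_pow hQ hQ']
  calc ∑ i, lam i ^ N ≤ ∑ i, c ^ N * ∑ j, O j i ^ 2 * μ j ^ N := Finset.sum_le_sum fun i _ => hle i
    _ = c ^ N * ∑ j, (∑ i, O j i ^ 2) * μ j ^ N := by
      rw [← Finset.mul_sum, Finset.sum_comm]
      simp only [Finset.sum_mul]
    _ = c ^ N * ∑ j, μ j ^ N := by simp [hrow]

/-- `A` has nonzero entries only between configurations of equal weight `d`. -/
def Conserves (A : Matrix n n ℝ) (d : n → ℝ) : Prop :=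
  ∀ x y, A x y ≠ 0 → d x = d y

theorem Conserves.comp {A : Matrix n n ℝ} {d : n → ℝ} (hA : Conserves A d) (f : ℝ → ℝ) :
    Conserves A (fun x => f (d x)) :=
  fun x y h => congrArg f (hA x y h)

theorem Conserves.commute {A : Matrix n n ℝ} {d : n → ℝ} (hA : Conserves A d) :
    A * diagonal d = diagonal d * A := by
  ext x y
  rw [mul_diagonal, diagonal_mul]
  by_cases h : A x y = 0
  · simp [h]
  · rw [hA x y h, mul_comm]

theorem Conserves.transpose {A : Matrix n n ℝ} {d : n → ℝ} (hA : Conserves A d) :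
    Conserves Aᵀ d := fun x y h => (hA y x h).symm

theorem Conserves.mul {A B : Matrix n n ℝ} {d : n → ℝ} (hA : Conserves A d)
    (hB : Conserves B d) : Conserves (A * B) d := by
  intro x y h
  rw [mul_apply] at h
  obtain ⟨k, -, hk⟩ := Finset.exists_ne_zero_of_sum_ne_zero h
  exact (hA x k (left_ne_zero_of_mul hk)).trans (hB k y (right_ne_zero_of_mul hk))

theorem Conserves.one (d : n → ℝ) : Conserves (1 : Matrix n n ℝ) d := by
  intro x y h
  by_contra hne
  exact h (one_apply_ne fun hxy => hne (by rw [hxy]))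

/-- A conserved weight commutes with `A`, so its `2N`-th root can be absorbed into each factor `A`.
This reduces weighted traces to unweighted ones. -/
theorem Conserves.pow_mul_diagonal {A : Matrix n n ℝ} {d : n → ℝ} (hd : ∀ x, 0 < d x)
    (hA : Conserves A d) {N : ℕ} (hN : N ≠ 0) :
    (Aᵀ * A) ^ N * diagonal d =
      ((A * diagonal fun x => d x ^ (1 / (2 * N : ℝ)))ᵀ *
        (A * diagonal fun x => d x ^ (1 / (2 * N : ℝ)))) ^ N := by
  set e : n → ℝ := fun x => d x ^ (1 / (2 * N : ℝ)) with he
  have hAe : Conserves A e := hA.comp fun t => t ^ (1 / (2 * N : ℝ))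
  have h1 : (A * diagonal e)ᵀ * (A * diagonal e) = (Aᵀ * A) * diagonal (fun x => e x * e x) := by
    rw [transpose_mul, diagonal_transpose, ← hAe.transpose.commute, mul_assoc,
      ← mul_assoc (diagonal e), ← hAe.commute, mul_assoc A, diagonal_mul_diagonal, mul_assoc]
  have h2 : Commute (Aᵀ * A) (diagonal fun x => e x * e x) :=
    (hA.transpose.mul hA).comp (fun t => t ^ (1 / (2 * N : ℝ)) * t ^ (1 / (2 * N : ℝ))) |>.commute
  rw [h1, h2.mul_pow, diagonal_pow]
  congr 2
  ext x
  have : ((2 * N : ℝ)) ≠ 0 := by positivity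
  simp only [Pi.pow_apply, he]
  rw [← pow_two, ← pow_mul, ← Real.rpow_natCast, ← Real.rpow_mul (hd x).le]
  push_cast
  rw [one_div, inv_mul_cancel₀ this, Real.rpow_one]

theorem trace_pow_mul_diagonal_le {A B : Matrix n n ℝ} {d : n → ℝ} (hd : ∀ x, 0 < d x)
    (hA : Conserves A d) (hB : Conserves B d) {c : ℝ} (hc : 0 ≤ c)
    (h : ∀ v : n → ℝ, ∑ i, (A *ᵥ v) i ^ 2 ≤ c * ∑ i, (B *ᵥ v) i ^ 2) {N : ℕ} (hN : N ≠ 0) :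
    ((Aᵀ * A) ^ N * diagonal d).trace ≤ c ^ N * ((Bᵀ * B) ^ N * diagonal d).trace := by
  have h1 := hA.pow_mul_diagonal hd hN
  have h2 := hB.pow_mul_diagonal hd hN
  rw [h1, h2]
  refine trace_pow_transpose_mul_self_le _ _ hc (fun v => ?_) N
  rw [← mulVec_mulVec, ← mulVec_mulVec]
  exact h _

end TraceMonotone

end XXZ

namespace XXZ

open Matrix Finset
open scoped Kronecker Matrix.Norms.L2Operator

/-! ### Two-site gates and the transport of local operators -/

section Gates

variable {α β : Type*} [Fintype α] [DecidableEq α] [Fintype β] [DecidableEq β]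

/-- A four-by-four matrix acting on the first two factors of `ℂ² ⊗ ℂ² ⊗ α`. -/
noncomputable def gate (α : Type*) [Fintype α] [DecidableEq α] (X : Matrix (Fin 2 × Fin 2) (Fin 2 × Fin 2) ℝ) :
    Matrix (Fin 2 × Fin 2 × α) (Fin 2 × Fin 2 × α) ℝ :=
  (X ⊗ₖ (1 : Matrix α α ℝ)).submatrix (Equiv.prodAssoc _ _ _).symm (Equiv.prodAssoc _ _ _).symm

theorem gate_apply (X : Matrix (Fin 2 × Fin 2) (Fin 2 × Fin 2) ℝ) (p q : Fin 2 × Fin 2 × α) :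
    gate α X p q = X (p.1, p.2.1) (q.1, q.2.1) * (1 : Matrix α α ℝ) p.2.2 q.2.2 := rfl

theorem gate_mul (X Y : Matrix (Fin 2 × Fin 2) (Fin 2 × Fin 2) ℝ) :
    gate α (X * Y) = gate α X * gate α Y := by
  rw [gate, gate, gate, submatrix_mul_equiv, ← mul_kronecker_mul, one_mul]

theorem gate_add (X Y : Matrix (Fin 2 × Fin 2) (Fin 2 × Fin 2) ℝ) :
    gate α (X + Y) = gate α X + gate α Y := by
  ext p q; simp only [gate_apply, Matrix.add_apply, add_mul]

theorem gate_one : gate α 1 = 1 := by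
  rw [gate, one_kronecker_one, submatrix_one_equiv]

theorem gate_transpose (X : Matrix (Fin 2 × Fin 2) (Fin 2 × Fin 2) ℝ) :
    (gate α X)ᵀ = gate α Xᵀ := by
  ext p q
  rw [transpose_apply, gate_apply, gate_apply, transpose_apply, ← transpose_apply (1 : Matrix α α ℝ),
    transpose_one]

theorem gate_kronecker_one (A : Matrix (Fin 2) (Fin 2) ℝ) :
    gate α (A ⊗ₖ (1 : Matrix (Fin 2) (Fin 2) ℝ)) = A ⊗ₖ (1 : Matrix (Fin 2 × α) (Fin 2 × α) ℝ) := by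
  rw [← one_kronecker_one]
  ext p q
  rw [gate_apply, kronecker_apply, kronecker_apply, kronecker_apply, mul_assoc]

/-- The coefficient of the matrix unit `e_{kl}` of the second tensor factor. -/
noncomputable def block (X : Matrix (Fin 2 × Fin 2) (Fin 2 × Fin 2) ℝ) (k l : Fin 2) :
    Matrix (Fin 2) (Fin 2) ℝ :=
  Matrix.of fun i j => X (i, k) (j, l)

theorem norm_block_le (X : Matrix (Fin 2 × Fin 2) (Fin 2 × Fin 2) ℝ) (k l : Fin 2) :
    ‖block X k l‖ ≤ ‖X‖ := by
  refine l2_opNorm_le_of_sum_sq _ (norm_nonneg _) fun v => ?_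
  have h := sum_sq_mulVec_le X fun p => if p.2 = l then v p.1 else 0
  rw [Fintype.sum_prod_type_right, Fintype.sum_prod_type_right] at h
  have h2 : ∑ j, ∑ i, (fun p : Fin 2 × Fin 2 => if p.2 = l then v p.1 else 0) (i, j) ^ 2
      = ∑ i, v i ^ 2 := by
    rw [Finset.sum_eq_single l]
    · simp
    · intro b _ hb; simp [hb]
    · simp
  rw [h2] at h
  refine le_trans ?_ h
  refine le_trans (le_of_eq ?_) (Finset.single_le_sum (f := fun j => ∑ i,
    (X *ᵥ fun p : Fin 2 × Fin 2 => if p.2 = l then v p.1 else 0) (i, j) ^ 2)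
    (fun j _ => Finset.sum_nonneg fun i _ => sq_nonneg _) (Finset.mem_univ k))
  refine Finset.sum_congr rfl fun i _ => ?_
  simp [mulVec, dotProduct, block, Fintype.sum_prod_type]

theorem gate_eq_sum (X : Matrix (Fin 2 × Fin 2) (Fin 2 × Fin 2) ℝ) :
    gate α X = ∑ k, ∑ l, block X k l ⊗ₖ (Matrix.single k l (1 : ℝ) ⊗ₖ (1 : Matrix α α ℝ)) := by
  ext ⟨i, k, x⟩ ⟨j, l, y⟩
  simp only [Matrix.sum_apply, kronecker_apply, gate_apply, block, Matrix.of_apply, single_apply]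
  rw [Finset.sum_eq_single k, Finset.sum_eq_single l]
  · simp
  · intro b _ hb; simp [hb]
  · simp
  · intro b _ hb; simp [hb]
  · simp

/-- Operators on the first factor can be moved from the right to the left of `S` at the cost of
a factor `2` in the norm. -/
def Transports (S : Matrix (Fin 2 × α) (Fin 2 × α) ℝ) : Prop :=
  ∀ k l : Fin 2, ∃ Y, S * (Matrix.single k l (1 : ℝ) ⊗ₖ (1 : Matrix α α ℝ)) = Y * S ∧ ‖Y‖ ≤ 2

theorem transports_one : Transports (1 : Matrix (Fin 2 × α) (Fin 2 × α) ℝ) := fun k l =>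
  ⟨_, by rw [one_mul, mul_one], (norm_kronecker_one_le _).trans ((norm_single_le _ _ _).trans
    (by norm_num))⟩

/-- Expanding the gate in matrix units of the site shared with `S` gives four terms. Each costs a
factor `2` to transport, whence `8`. -/
theorem Transports.exists_gate {S : Matrix (Fin 2 × α) (Fin 2 × α) ℝ} (hS : Transports S)
    (X : Matrix (Fin 2 × Fin 2) (Fin 2 × Fin 2) ℝ) :
    ∃ Y, ((1 : Matrix (Fin 2) (Fin 2) ℝ) ⊗ₖ S) * gate α X =
      Y * ((1 : Matrix (Fin 2) (Fin 2) ℝ) ⊗ₖ S) ∧ ‖Y‖ ≤ 8 * ‖X‖ := by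
  choose Y hY hY2 using hS
  refine ⟨∑ k, ∑ l, block X k l ⊗ₖ Y k l, ?_, ?_⟩
  · rw [gate_eq_sum]
    simp only [Finset.mul_sum, Finset.sum_mul, ← mul_kronecker_mul, hY, one_mul, mul_one]
  · have h : ∀ k l, ‖block X k l ⊗ₖ Y k l‖ ≤ ‖X‖ * 2 := fun k l =>
      (norm_kronecker_le _ _).trans
        (mul_le_mul (norm_block_le X k l) (hY2 k l) (norm_nonneg _) (norm_nonneg _))
    refine (norm_sum_le_of_le _ fun k _ => norm_sum_le_of_le _ fun l _ => h k l).trans ?_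
    simp only [Finset.sum_const, Finset.card_univ, Fintype.card_fin, nsmul_eq_mul]
    norm_num
    linarith

theorem exists_left_inverse {R : Matrix α α ℝ} (hR : ‖R - 1‖ ≤ 1 / 2) :
    ∃ R', R' * R = 1 ∧ ‖R'‖ ≤ 2 := by
  have : CompleteSpace (Matrix α α ℝ) := FiniteDimensional.complete ℝ _
  have h1 : ‖1 - R‖ < 1 := by rw [norm_sub_rev]; linarith
  set u := Units.oneSub (1 - R) h1 with hu
  have huR : (u : Matrix α α ℝ) = R := by rw [hu, Units.val_oneSub]; abel
  have h2 : (↑u⁻¹ : Matrix α α ℝ) * R = 1 := by rw [← huR, Units.inv_mul]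
  refine ⟨↑u⁻¹, h2, ?_⟩
  have h3 : (↑u⁻¹ : Matrix α α ℝ) = 1 - (↑u⁻¹ : Matrix α α ℝ) * (R - 1) := by rw [mul_sub, h2]; simp
  have h4 : ‖(↑u⁻¹ : Matrix α α ℝ)‖ ≤ 1 + ‖(↑u⁻¹ : Matrix α α ℝ)‖ * (1 / 2) := by
    conv_lhs => rw [h3]
    refine (norm_sub_le _ _).trans (add_le_add (norm_le_one_of_transpose_mul_self (by simp)) ?_)
    exact (norm_mul_le _ _).trans (mul_le_mul_of_nonneg_left hR (norm_nonneg _))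
  linarith

/-- The bound `2` reproduces itself when a gate is added. A matrix unit `E` on the new site commutes
with `S`; passing it through `R` leaves an error `D` on two sites, and `S` turns this into an
operator of norm at most `8 ‖D‖ ≤ 1`. The total is at most `1 + 1`. -/
theorem Transports.step {S : Matrix (Fin 2 × α) (Fin 2 × α) ℝ} (hS : Transports S)
    {R : Matrix (Fin 2 × Fin 2) (Fin 2 × Fin 2) ℝ} (hR : ‖R - 1‖ ≤ 1 / 32) :
    Transports (((1 : Matrix (Fin 2) (Fin 2) ℝ) ⊗ₖ S) * gate α R) := by
  obtain ⟨R', h1, h2⟩ := exists_left_inverse (hR.trans (by norm_num))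
  intro k l
  set E : Matrix (Fin 2 × Fin 2) (Fin 2 × Fin 2) ℝ :=
    Matrix.single k l (1 : ℝ) ⊗ₖ (1 : Matrix (Fin 2) (Fin 2) ℝ) with hE
  -- The commutator of `R` and `E` times the inverse of `R`: norm at most `(2/32) * 2 = 1/8`.
  set D := ((R - 1) * E - E * (R - 1)) * R' with hD
  have hE1 : ‖E‖ ≤ 1 := (norm_kronecker_one_le _).trans ((norm_single_le _ _ _).trans (by norm_num))
  have hRE : R * E = (E + D) * R := by
    rw [add_mul, hD, mul_assoc _ R', h1, mul_one, sub_mul, mul_sub]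
    simp
  have hDn : ‖D‖ ≤ 1 / 8 := by
    have e1 : ‖(R - 1) * E‖ ≤ 1 / 32 := (norm_mul_le _ _).trans
      ((mul_le_mul hR hE1 (norm_nonneg _) (by norm_num)).trans (by norm_num))
    have e2 : ‖E * (R - 1)‖ ≤ 1 / 32 := (norm_mul_le _ _).trans
      ((mul_le_mul hE1 hR (norm_nonneg _) (by norm_num)).trans (by norm_num))
    have e3 : ‖(R - 1) * E - E * (R - 1)‖ ≤ 1 / 16 := (norm_sub_le _ _).trans (by linarith)
    exact (norm_mul_le _ _).trans
      ((mul_le_mul e3 h2 (norm_nonneg _) (by norm_num)).trans (by norm_num))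
  obtain ⟨Y, hY, hYn⟩ := hS.exists_gate D
  refine ⟨(Matrix.single k l (1 : ℝ)) ⊗ₖ (1 : Matrix (Fin 2 × α) (Fin 2 × α) ℝ) + Y, ?_, ?_⟩
  · rw [mul_assoc, ← gate_kronecker_one, ← hE, ← gate_mul, hRE, gate_mul, ← mul_assoc, gate_add,
      mul_add, hY, ← mul_assoc, add_mul (gate α E), hE, gate_kronecker_one, ← mul_kronecker_mul,
      ← mul_kronecker_mul, one_mul, mul_one, one_mul, mul_one]
  · refine (norm_add_le _ _).trans ?_
    have : ‖(Matrix.single k l (1 : ℝ)) ⊗ₖ (1 : Matrix (Fin 2 × α) (Fin 2 × α) ℝ)‖ ≤ 1 :=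
      (norm_kronecker_one_le _).trans ((norm_single_le _ _ _).trans (by norm_num))
    linarith

theorem Conserves.kronecker {A : Matrix α α ℝ} {B : Matrix β β ℝ} {d : α → ℝ} {e : β → ℝ}
    (hA : Conserves A d) (hB : Conserves B e) :
    Conserves (A ⊗ₖ B) (fun p => d p.1 * e p.2) := by
  intro x y h
  rw [kronecker_apply] at h
  exact congrArg₂ (· * ·) (hA _ _ (left_ne_zero_of_mul h)) (hB _ _ (right_ne_zero_of_mul h))

theorem Conserves.gate {X : Matrix (Fin 2 × Fin 2) (Fin 2 × Fin 2) ℝ} {d : Fin 2 → ℝ} {e : α → ℝ}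
    (hX : Conserves X fun p => d p.1 * d p.2) :
    Conserves (gate α X) (fun p => d p.1 * (d p.2.1 * e p.2.2)) := by
  intro x y h
  have := hX.kronecker (Conserves.one e) _ _ h
  simpa [mul_assoc] using this

end Gates

end XXZ

/-! ### Staircases, shifts, and the effect of removing one gate -/

namespace XXZ

open Matrix Finset
open scoped Kronecker Matrix.Norms.L2Operator

/-- Spin configurations of a chain, as iterated pairs. -/
def Conf : ℕ → Type
  | 0 => Unit
  | n + 1 => Fin 2 × Conf n

instance Conf.fintype : ∀ n, Fintype (Conf n)
  | 0 => inferInstanceAs (Fintype Unit)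
  | n + 1 => letI := Conf.fintype n; inferInstanceAs (Fintype (Fin 2 × Conf n))

instance Conf.decidableEq : ∀ n, DecidableEq (Conf n)
  | 0 => inferInstanceAs (DecidableEq Unit)
  | n + 1 => letI := Conf.decidableEq n; inferInstanceAs (DecidableEq (Fin 2 × Conf n))

/-- The product weight of a configuration. -/
noncomputable def Conf.weight (d : Fin 2 → ℝ) : ∀ n, Conf n → ℝ
  | 0, _ => 1
  | n + 1, x => d x.1 * Conf.weight d n x.2

theorem Conf.weight_pos {d : Fin 2 → ℝ} (hd : ∀ i, 0 < d i) : ∀ n x, 0 < Conf.weight d n x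
  | 0, _ => one_pos
  | n + 1, x => mul_pos (hd _) (Conf.weight_pos hd n x.2)

/-- The flip of the two tensor factors. -/
noncomputable def flip : Matrix (Fin 2 × Fin 2) (Fin 2 × Fin 2) ℝ :=
  Matrix.of fun p q => if p = q.swap then 1 else 0

theorem flip_transpose_mul_self : flipᵀ * flip = 1 := by
  ext p q
  rw [mul_apply, Finset.sum_eq_single p.swap]
  · simp [flip, one_apply]
  · intro b _ hb
    have : b ≠ p.swap := hb
    simp [flip, this]
  · simp

theorem flip_conserves (d : Fin 2 → ℝ) : Conserves flip fun p => d p.1 * d p.2 := by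
  intro x y h
  have : x = y.swap := by
    by_contra h'
    exact h (by simp [flip, h'])
  subst this
  exact mul_comm _ _

variable (R : Matrix (Fin 2 × Fin 2) (Fin 2 × Fin 2) ℝ)

/-- The ordered product of the gates `R` on neighbouring sites of an open chain. -/
noncomputable def stair : ∀ n, Matrix (Fin 2 × Conf n) (Fin 2 × Conf n) ℝ
  | 0 => 1
  | n + 1 => ((1 : Matrix (Fin 2) (Fin 2) ℝ) ⊗ₖ stair n) * gate (Conf n) R

/-- The cyclic shift. -/
noncomputable def shift : ∀ n, Matrix (Fin 2 × Conf n) (Fin 2 × Conf n) ℝ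
  | 0 => 1
  | n + 1 => gate (Conf n) flip * ((1 : Matrix (Fin 2) (Fin 2) ℝ) ⊗ₖ shift n)

/-- The monodromy matrix of the row-to-row transfer matrix. -/
noncomputable def rowMonodromy (n : ℕ) : Matrix (Fin 2 × Conf n) (Fin 2 × Conf n) ℝ := shift n * stair R n

/-- The row-to-row transfer matrix on a periodic chain of `n + 1` sites, with `R` the braided
form of the vertex weights. -/
noncomputable def rowTransfer (n : ℕ) : Matrix (Fin 2 × Conf n) (Fin 2 × Conf n) ℝ :=
  Matrix.of fun p q => ∑ s, ∑ u, R (p.1, u) (s, q.1) * rowMonodromy R n (s, p.2) (u, q.2)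

variable {R}

theorem flip_gate_transpose_mul_self {α : Type*} [Fintype α] [DecidableEq α]
    {U : Matrix (Fin 2 × α) (Fin 2 × α) ℝ} (hU : Uᵀ * U = 1) :
    (gate α flip * ((1 : Matrix (Fin 2) (Fin 2) ℝ) ⊗ₖ U))ᵀ *
      (gate α flip * ((1 : Matrix (Fin 2) (Fin 2) ℝ) ⊗ₖ U)) = 1 := by
  rw [transpose_mul, gate_transpose, mul_assoc, ← mul_assoc (gate _ _), ← gate_mul,
    flip_transpose_mul_self, gate_one, one_mul, ← kroneckerMap_transpose, transpose_one,
    ← mul_kronecker_mul, hU, one_mul, one_kronecker_one]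

theorem shift_transpose_mul_self : ∀ n, (shift n)ᵀ * shift n = 1
  | 0 => by simp [shift]
  | n + 1 => flip_gate_transpose_mul_self (shift_transpose_mul_self n)

theorem stair_transports (hR : ‖R - 1‖ ≤ 1 / 32) : ∀ n, Transports (stair R n)
  | 0 => transports_one
  | n + 1 => (stair_transports hR n).step hR

theorem stair_conserves {d : Fin 2 → ℝ} (hR : Conserves R fun p => d p.1 * d p.2) :
    ∀ n, Conserves (stair R n) fun p => d p.1 * Conf.weight d n p.2
  | 0 => Conserves.one _
  | n + 1 => ((Conserves.one d).kronecker (stair_conserves hR n)).mul (hR.gate)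

theorem shift_conserves (d : Fin 2 → ℝ) :
    ∀ n, Conserves (shift n) fun p => d p.1 * Conf.weight d n p.2
  | 0 => Conserves.one _
  | n + 1 => ((flip_conserves d).gate).mul ((Conserves.one d).kronecker (shift_conserves d n))

/-- The ice rule holds at the closing vertex and for the monodromy matrix. In the product of the two
relations the weights of the summed auxiliary spins cancel, being nonzero. -/
theorem rowTransfer_conserves {d : Fin 2 → ℝ} (hd : ∀ i, 0 < d i)
    (hR : Conserves R fun p => d p.1 * d p.2) (n : ℕ) :
    Conserves (rowTransfer R n) fun p => d p.1 * Conf.weight d n p.2 := by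
  intro p q h
  rw [rowTransfer, of_apply] at h
  obtain ⟨s, -, h⟩ := Finset.exists_ne_zero_of_sum_ne_zero h
  obtain ⟨u, -, h⟩ := Finset.exists_ne_zero_of_sum_ne_zero h
  have h1 : d p.1 * d u = d s * d q.1 := hR _ _ (left_ne_zero_of_mul h)
  have h2 : d s * Conf.weight d n p.2 = d u * Conf.weight d n q.2 :=
    ((shift_conserves d n).mul (stair_conserves hR n)) _ _ (right_ne_zero_of_mul h)
  have h3 : d s * d u ≠ 0 := (mul_pos (hd s) (hd u)).ne'
  apply mul_left_cancel₀ h3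
  linear_combination (d s * Conf.weight d n p.2) * h1 + d s * d q.1 * h2

theorem kronecker_one_mul_mul_kronecker_one_apply {α : Type*} [Fintype α] [DecidableEq α]
    (A B : Matrix (Fin 2) (Fin 2) ℝ) (W : Matrix (Fin 2 × α) (Fin 2 × α) ℝ) (p q : Fin 2 × α) :
    ((A ⊗ₖ (1 : Matrix α α ℝ)) * W * (B ⊗ₖ (1 : Matrix α α ℝ))) p q =
      ∑ s, ∑ u, A p.1 s * W (s, p.2) (u, q.2) * B u q.1 := by
  have h1 : ∀ u z, ((A ⊗ₖ (1 : Matrix α α ℝ)) * W) p (u, z) = ∑ s, A p.1 s * W (s, p.2) (u, z) := by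
    intro u z
    simp [mul_apply, Fintype.sum_prod_type, one_apply]
  have h2 : ∀ u, ∑ z, ((A ⊗ₖ (1 : Matrix α α ℝ)) * W) p (u, z) *
      (B ⊗ₖ (1 : Matrix α α ℝ)) (u, z) q = ∑ s, A p.1 s * W (s, p.2) (u, q.2) * B u q.1 := by
    intro u
    rw [Finset.sum_eq_single q.2]
    · rw [h1, Finset.sum_mul]
      simp
    · intro z _ hz
      simp [hz]
    · simp
  rw [mul_apply, Fintype.sum_prod_type, Finset.sum_congr rfl fun u _ => h2 u]
  exact Finset.sum_comm

/-- With `R = 1` at the closing vertex the transfer matrix is the monodromy matrix itself; the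
double sum is the correction linear in `R - 1`. -/
theorem rowTransfer_eq (n : ℕ) :
    rowTransfer R n = rowMonodromy R n + ∑ k, ∑ l,
      (block (R - 1) k l ⊗ₖ (1 : Matrix (Conf n) (Conf n) ℝ)) * rowMonodromy R n *
        (Matrix.single k l (1 : ℝ) ⊗ₖ (1 : Matrix (Conf n) (Conf n) ℝ)) := by
  ext p q
  simp only [Matrix.add_apply, Matrix.sum_apply, kronecker_one_mul_mul_kronecker_one_apply]
  simp only [rowTransfer, block, of_apply, single_apply, Matrix.sub_apply, one_apply,
    Fin.sum_univ_two, Prod.mk.injEq]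
  obtain ⟨i, x⟩ := p
  obtain ⟨j, y⟩ := q
  fin_cases i <;> fin_cases j <;> simp <;> ring

/-- The matrix units to the right of the staircase are transported to its left. The correction then
has four terms of norm at most `2 ‖R - 1‖`, independently of the length, and the orthogonal shift
factors out. -/
theorem exists_rowTransfer_eq (hR : ‖R - 1‖ ≤ 1 / 32) (n : ℕ) :
    ∃ Y, rowTransfer R n = shift n * ((1 + Y) * stair R n) ∧ ‖Y‖ ≤ 8 * ‖R - 1‖ := by
  choose Y hY hYn using stair_transports hR n
  have hU := shift_transpose_mul_self n
  have hU' : shift n * (shift n)ᵀ = 1 := mul_eq_one_comm.mp hU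
  refine ⟨∑ k, ∑ l, (shift n)ᵀ * (block (R - 1) k l ⊗ₖ (1 : Matrix (Conf n) (Conf n) ℝ)) *
    shift n * Y k l, ?_, ?_⟩
  · rw [rowTransfer_eq, rowMonodromy, add_mul, one_mul, mul_add]
    congr 1
    simp only [Finset.sum_mul, Finset.mul_sum]
    refine Finset.sum_congr rfl fun k _ => Finset.sum_congr rfl fun l _ => ?_
    simp only [mul_assoc, hY]
    rw [← mul_assoc (shift n) (shift n)ᵀ, hU', one_mul]
  · have h1 : ‖shift n‖ ≤ 1 := norm_le_one_of_transpose_mul_self hU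
    have h2 : ‖(shift n)ᵀ‖ ≤ 1 :=
      norm_le_one_of_transpose_mul_self (by rw [transpose_transpose, hU'])
    have h3 : ∀ k l, ‖(shift n)ᵀ * (block (R - 1) k l ⊗ₖ (1 : Matrix (Conf n) (Conf n) ℝ)) *
        shift n * Y k l‖ ≤ 1 * ‖R - 1‖ * 1 * 2 := fun k l =>
      norm_mul_le_of_le (norm_mul_le_of_le (norm_mul_le_of_le h2
        ((norm_kronecker_one_le _).trans (norm_block_le _ k l))) h1) (hYn k l)
    refine (norm_sum_le_of_le _ fun k _ => norm_sum_le_of_le _ fun l _ => h3 k l).trans ?_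
    simp only [Finset.sum_const, Finset.card_univ, Fintype.card_fin, nsmul_eq_mul]
    norm_num
    linarith

/-- Cutting a chain into two. -/
def Conf.split (m : ℕ) : ∀ n, Conf (m + n) ≃ Conf n × Conf m
  | 0 => (Equiv.punitProd _).symm
  | n + 1 => ((Equiv.refl (Fin 2)).prodCongr (Conf.split m n)).trans (Equiv.prodAssoc _ _ _).symm

theorem Conf.weight_split (d : Fin 2 → ℝ) (m : ℕ) : ∀ (n : ℕ) (x : Conf (m + n)),
    Conf.weight d (m + n) x = Conf.weight d n (split m n x).1 * Conf.weight d m (split m n x).2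
  | 0, x => (one_mul _).symm
  | n + 1, x => by
    change d x.1 * Conf.weight d (m + n) x.2 = d x.1 * Conf.weight d n (split m n x.2).1 *
      Conf.weight d m (split m n x.2).2
    rw [Conf.weight_split d m n, mul_assoc]

/-- The staircase of a chain cut into two. -/
noncomputable def cutStair (R : Matrix (Fin 2 × Fin 2) (Fin 2 × Fin 2) ℝ) (m n : ℕ) :
    Matrix (Fin 2 × Conf (m + 1 + n)) (Fin 2 × Conf (m + 1 + n)) ℝ :=
  (stair R n ⊗ₖ stair R m).submatrix (Conf.split (m + 1) (n + 1)) (Conf.split (m + 1) (n + 1))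

/-- The added gate touches only the left piece of the cut chain, so lengthening that piece commutes
with cutting. -/
theorem one_kronecker_submatrix_mul_gate {α β γ : Type*} [Fintype α] [DecidableEq α] [Fintype β]
    [DecidableEq β] [Fintype γ] [DecidableEq γ] (e : α ≃ β × γ)
    (A : Matrix (Fin 2 × β) (Fin 2 × β) ℝ) (B : Matrix γ γ ℝ) :
    ((1 : Matrix (Fin 2) (Fin 2) ℝ) ⊗ₖ ((A ⊗ₖ B).submatrix
        (((Equiv.refl (Fin 2)).prodCongr e).trans (Equiv.prodAssoc _ _ _).symm)
        (((Equiv.refl (Fin 2)).prodCongr e).trans (Equiv.prodAssoc _ _ _).symm))) * gate α R =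
      ((((1 : Matrix (Fin 2) (Fin 2) ℝ) ⊗ₖ A) * gate β R) ⊗ₖ B).submatrix
        (((Equiv.refl (Fin 2)).prodCongr (((Equiv.refl (Fin 2)).prodCongr e).trans
          (Equiv.prodAssoc _ _ _).symm)).trans (Equiv.prodAssoc _ _ _).symm)
        (((Equiv.refl (Fin 2)).prodCongr (((Equiv.refl (Fin 2)).prodCongr e).trans
          (Equiv.prodAssoc _ _ _).symm)).trans (Equiv.prodAssoc _ _ _).symm) := by
  set f := ((Equiv.refl (Fin 2)).prodCongr (((Equiv.refl (Fin 2)).prodCongr e).trans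
          (Equiv.prodAssoc _ _ _).symm)).trans (Equiv.prodAssoc _ _ _).symm with hf
  have h1 : gate α R = (gate β R ⊗ₖ (1 : Matrix γ γ ℝ)).submatrix f f := by
    ext ⟨i, j, x⟩ ⟨k, l, y⟩
    change R (i, j) (k, l) * (1 : Matrix α α ℝ) x y = R (i, j) (k, l) *
      (1 : Matrix β β ℝ) (e x).1 (e y).1 * (1 : Matrix γ γ ℝ) (e x).2 (e y).2
    have : (1 : Matrix α α ℝ) x y =
        (1 : Matrix β β ℝ) (e x).1 (e y).1 * (1 : Matrix γ γ ℝ) (e x).2 (e y).2 := by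
      simp only [one_apply, ← e.injective.eq_iff (a := x), Prod.ext_iff]
      split_ifs <;> simp_all
    rw [this, mul_assoc]
  have h2 : ((1 : Matrix (Fin 2) (Fin 2) ℝ) ⊗ₖ ((A ⊗ₖ B).submatrix
        (((Equiv.refl (Fin 2)).prodCongr e).trans (Equiv.prodAssoc _ _ _).symm)
        (((Equiv.refl (Fin 2)).prodCongr e).trans (Equiv.prodAssoc _ _ _).symm))) =
      (((1 : Matrix (Fin 2) (Fin 2) ℝ) ⊗ₖ A) ⊗ₖ B).submatrix f f := by
    ext ⟨i, j, x⟩ ⟨k, l, y⟩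
    exact (mul_assoc _ _ _).symm
  rw [h1, h2, submatrix_mul_equiv, ← mul_kronecker_mul, mul_one]

theorem cutStair_succ (m n : ℕ) : cutStair R m (n + 1) =
    ((1 : Matrix (Fin 2) (Fin 2) ℝ) ⊗ₖ cutStair R m n) * gate (Conf (m + 1 + n)) R :=
  (one_kronecker_submatrix_mul_gate (Conf.split (m + 1) n) (stair R n) (stair R m)).symm

theorem cutStair_zero (m : ℕ) : cutStair R m 0 = (1 : Matrix (Fin 2) (Fin 2) ℝ) ⊗ₖ stair R m := by
  ext ⟨i, x⟩ ⟨j, y⟩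
  change (1 : Matrix (Fin 2 × Conf 0) (Fin 2 × Conf 0) ℝ) (i, ()) (j, ()) * stair R m x y =
    (1 : Matrix (Fin 2) (Fin 2) ℝ) i j * stair R m x y
  congr 1
  by_cases h : i = j
  · subst h; rw [one_apply_eq, one_apply_eq]
  · rw [one_apply_ne h, one_apply_ne fun h' => h (congrArg Prod.fst h')]

theorem one_kronecker_mul_gate_eq {α : Type*} [Fintype α] [DecidableEq α]
    {S : Matrix (Fin 2 × α) (Fin 2 × α) ℝ} {Y : Matrix (Fin 2 × Fin 2 × α) (Fin 2 × Fin 2 × α) ℝ}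
    (h : ((1 : Matrix (Fin 2) (Fin 2) ℝ) ⊗ₖ S) * gate α (R - 1) =
      Y * ((1 : Matrix (Fin 2) (Fin 2) ℝ) ⊗ₖ S)) :
    ((1 : Matrix (Fin 2) (Fin 2) ℝ) ⊗ₖ S) * gate α R =
      (1 + Y) * ((1 : Matrix (Fin 2) (Fin 2) ℝ) ⊗ₖ S) := by
  have : gate α R = gate α (R - 1) + 1 := by rw [← gate_one, ← gate_add, sub_add_cancel]
  rw [this, mul_add, h, mul_one, add_mul, one_mul, add_comm]

theorem one_kronecker_one_add_mul {α : Type*} [Fintype α] [DecidableEq α]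
    (Q Y : Matrix α α ℝ) (G : Matrix (Fin 2 × α) (Fin 2 × α) ℝ) :
    ((1 : Matrix (Fin 2) (Fin 2) ℝ) ⊗ₖ ((1 + Y) * Q)) * G =
      (1 + (1 : Matrix (Fin 2) (Fin 2) ℝ) ⊗ₖ Y) * (((1 : Matrix (Fin 2) (Fin 2) ℝ) ⊗ₖ Q) * G) := by
  rw [← mul_assoc]
  congr 1
  rw [add_mul, one_mul, add_mul, one_mul, kronecker_add, ← mul_kronecker_mul, one_mul]

/-- The two staircases differ by the one gate across the cut. When the left piece is a single site,
this gate is rightmost and is transported through the right piece. Further gates multiply on the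
right, so `Y` only gains a tensor factor `1`. -/
theorem exists_stair_eq (hR : ‖R - 1‖ ≤ 1 / 32) (m : ℕ) : ∀ n,
    ∃ Y, stair R (m + 1 + n) = (1 + Y) * cutStair R m n ∧ ‖Y‖ ≤ 8 * ‖R - 1‖
  | 0 => by
    obtain ⟨Y, hY, hYn⟩ := (stair_transports hR m).exists_gate (R - 1)
    refine ⟨Y, ?_, hYn⟩
    rw [cutStair_zero]
    exact one_kronecker_mul_gate_eq hY
  | n + 1 => by
    obtain ⟨Y, hY, hYn⟩ := exists_stair_eq hR m n
    refine ⟨(1 : Matrix (Fin 2) (Fin 2) ℝ) ⊗ₖ Y, ?_, (norm_one_kronecker_le Y).trans hYn⟩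
    rw [cutStair_succ]
    refine Eq.trans ?_ (one_kronecker_one_add_mul (cutStair R m n) Y _)
    rw [← hY]
    rfl

end XXZ

namespace XXZ

open Matrix Finset
open scoped Kronecker Matrix.Norms.L2Operator

/-! ### Weighted traces and their comparison -/

section WeightedTrace

variable {n m : Type*} [Fintype n] [DecidableEq n] [Fintype m] [DecidableEq m]

/-- The trace of `(Aᵀ A) ^ N` with diagonal weight `d`. -/
noncomputable def weightedTrace (A : Matrix n n ℝ) (d : n → ℝ) (N : ℕ) : ℝ := ((Aᵀ * A) ^ N * diagonal d).trace

/-- Comparison with the zero matrix, whose weighted trace vanishes because `N ≠ 0`. -/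
theorem weightedTrace_nonneg {A : Matrix n n ℝ} {d : n → ℝ} (hd : ∀ x, 0 < d x)
    (hA : Conserves A d) {N : ℕ} (hN : N ≠ 0) : 0 ≤ weightedTrace A d N := by
  have h := trace_pow_mul_diagonal_le (A := 0) hd (fun x y h => absurd rfl h) hA zero_le_one
    (fun v => by simpa using Finset.sum_nonneg fun i _ => sq_nonneg _) hN
  simpa [zero_pow hN, weightedTrace] using h

theorem submatrix_equiv_pow {K : Type*} [CommRing K] (A : Matrix n n K) (e : m ≃ n) (N : ℕ) :
    (A.submatrix e e) ^ N = (A ^ N).submatrix e e := by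
  induction N with
  | zero => rw [pow_zero, pow_zero, submatrix_one_equiv]
  | succ N ih => rw [pow_succ, pow_succ, ih, submatrix_mul_equiv]

theorem trace_submatrix_equiv {K : Type*} [CommRing K] (A : Matrix n n K) (e : m ≃ n) :
    (A.submatrix e e).trace = A.trace :=
  e.sum_comp fun i => A i i

theorem weightedTrace_submatrix (A : Matrix n n ℝ) (d : n → ℝ) (e : m ≃ n) (N : ℕ) :
    weightedTrace (A.submatrix e e) (d ∘ e) N = weightedTrace A d N := by
  rw [weightedTrace, weightedTrace, transpose_submatrix, submatrix_mul_equiv, submatrix_equiv_pow,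
    ← submatrix_diagonal_equiv, submatrix_mul_equiv, trace_submatrix_equiv]

theorem kronecker_pow (A : Matrix n n ℝ) (B : Matrix m m ℝ) (N : ℕ) :
    (A ⊗ₖ B) ^ N = (A ^ N) ⊗ₖ (B ^ N) := by
  induction N with
  | zero => rw [pow_zero, pow_zero, pow_zero, one_kronecker_one]
  | succ N ih => rw [pow_succ, pow_succ, pow_succ, ih, mul_kronecker_mul]

theorem weightedTrace_kronecker (A : Matrix n n ℝ) (B : Matrix m m ℝ) (d : n → ℝ) (e : m → ℝ)
    (N : ℕ) : weightedTrace (A ⊗ₖ B) (fun p => d p.1 * e p.2) N =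
      weightedTrace A d N * weightedTrace B e N := by
  rw [weightedTrace, weightedTrace, weightedTrace, ← kroneckerMap_transpose, ← mul_kronecker_mul,
    kronecker_pow, ← diagonal_kronecker_diagonal, ← mul_kronecker_mul, trace_kronecker]

/-- If `A = U (1 + Y) B` with `U` orthogonal and `Y` small, the weighted traces of `A` and `B`
bound each other. -/
theorem weightedTrace_le_of_eq {A B U Y : Matrix n n ℝ} {d : n → ℝ} (hd : ∀ x, 0 < d x)
    (hA : Conserves A d) (hB : Conserves B d) (hU : Uᵀ * U = 1) (h : A = U * ((1 + Y) * B))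
    {κ : ℝ} (hY : ‖Y‖ ≤ κ) (hκ : κ ≤ 1 / 2) {N : ℕ} (hN : N ≠ 0) :
    weightedTrace A d N ≤ ((1 + 2 * κ) ^ 2) ^ N * weightedTrace B d N ∧
      weightedTrace B d N ≤ ((1 + 2 * κ) ^ 2) ^ N * weightedTrace A d N := by
  have hκ0 := (norm_nonneg Y).trans hY
  have key : ∀ v, ∑ i, (A *ᵥ v) i ^ 2 = ∑ i, ((1 + Y) *ᵥ (B *ᵥ v)) i ^ 2 := by
    intro v
    rw [h, ← mulVec_mulVec, sum_sq_mulVec_of_transpose_mul_self hU, ← mulVec_mulVec]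
  constructor
  · refine trace_pow_mul_diagonal_le hd hA hB (sq_nonneg _) (fun v => ?_) hN
    rw [key]
    refine (norm_mulVec_one_add_le hY _).trans ?_
    have : 0 ≤ ∑ i, (B *ᵥ v) i ^ 2 := Finset.sum_nonneg fun i _ => sq_nonneg _
    gcongr
    linarith
  · refine trace_pow_mul_diagonal_le hd hB hA (sq_nonneg _) (fun v => ?_) hN
    rw [key]
    exact le_norm_mulVec_one_add hY hκ _

end WeightedTrace

/-! ### Almost multiplicativity of partition functions in the length -/

section Partition

variable (R : Matrix (Fin 2 × Fin 2) (Fin 2 × Fin 2) ℝ) (d : Fin 2 → ℝ)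

/-- The partition function of the periodic chain with `n + 1` sites. -/
noncomputable def periodicPartition (n N : ℕ) : ℝ :=
  weightedTrace (rowTransfer R n) (Conf.weight d (n + 1)) N

/-- The partition function of the open chain with `n + 1` sites. -/
noncomputable def openPartition (n N : ℕ) : ℝ :=
  weightedTrace (stair R n) (Conf.weight d (n + 1)) N

variable {R d}

theorem openPartition_zero (N : ℕ) : openPartition R d 0 N = d 0 + d 1 := by
  change (((1 : Matrix (Fin 2 × Unit) (Fin 2 × Unit) ℝ)ᵀ * 1) ^ N *
    diagonal fun p : Fin 2 × Unit => d p.1 * 1).trace = _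
  rw [transpose_one, one_mul, one_pow, one_mul, trace_diagonal, Fintype.sum_prod_type]
  simp

variable (hd : ∀ i, 0 < d i) (hc : Conserves R fun p => d p.1 * d p.2) {κ : ℝ} (hR : ‖R - 1‖ ≤ κ)
  (hκ : κ ≤ 1 / 32) {N : ℕ} (hN : N ≠ 0)
include hd hc hR hκ hN

theorem openPartition_nonneg (n : ℕ) : 0 ≤ openPartition R d n N :=
  weightedTrace_nonneg (Conf.weight_pos hd (n + 1)) (stair_conserves hc n) hN

theorem periodicPartition_le_openPartition (n : ℕ) :
    periodicPartition R d n N ≤ ((1 + 16 * κ) ^ 2) ^ N * openPartition R d n N ∧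
      openPartition R d n N ≤ ((1 + 16 * κ) ^ 2) ^ N * periodicPartition R d n N := by
  obtain ⟨Y, hY, hYn⟩ := exists_rowTransfer_eq (hR.trans hκ) n
  have h := weightedTrace_le_of_eq (Conf.weight_pos hd (n + 1))
    (rowTransfer_conserves hd hc n) (stair_conserves hc n) (shift_transpose_mul_self n) hY
    (κ := 8 * κ) (hYn.trans (by linarith)) (by linarith) hN
  rw [show 1 + 16 * κ = 1 + 2 * (8 * κ) by ring]
  exact h

theorem openPartition_mul (m n : ℕ) :
    openPartition R d (m + 1 + n) N ≤
        ((1 + 16 * κ) ^ 2) ^ N * (openPartition R d n N * openPartition R d m N) ∧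
      openPartition R d n N * openPartition R d m N ≤
        ((1 + 16 * κ) ^ 2) ^ N * openPartition R d (m + 1 + n) N := by
  obtain ⟨Y, hY, hYn⟩ := exists_stair_eq (hR.trans hκ) m n
  have hw : (Conf.weight d (m + 1 + n + 1)) =
      (fun p : Conf (n + 1) × Conf (m + 1) => Conf.weight d (n + 1) p.1 * Conf.weight d (m + 1) p.2) ∘
        Conf.split (m + 1) (n + 1) := funext fun x => Conf.weight_split d (m + 1) (n + 1) x
  have hcut : weightedTrace (cutStair R m n) (Conf.weight d (m + 1 + n + 1)) N =
      openPartition R d n N * openPartition R d m N := by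
    rw [hw]
    refine (weightedTrace_submatrix _ _ _ N).trans ?_
    exact weightedTrace_kronecker (stair R n) (stair R m) _ _ N
  have hcc : Conserves (cutStair R m n) (Conf.weight d (m + 1 + n + 1)) := by
    rw [hw]
    intro x y h
    exact ((stair_conserves hc n).kronecker (stair_conserves hc m)) _ _ h
  have h := weightedTrace_le_of_eq
    (U := (1 : Matrix (Fin 2 × Conf (m + 1 + n)) (Fin 2 × Conf (m + 1 + n)) ℝ)) (Conf.weight_pos hd (m + 1 + n + 1))
    (stair_conserves hc (m + 1 + n)) hcc
    (by rw [transpose_one, one_mul]) (hY.trans (one_mul _).symm)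
    (κ := 8 * κ) (hYn.trans (by linarith)) (by linarith) hN
  rw [show 1 + 16 * κ = 1 + 2 * (8 * κ) by ring, ← hcut]
  exact h

variable {K : ℝ} (hK : ((1 + 16 * κ) ^ 2) ^ N ≤ K)
include hK

theorem le_periodicPartition_zero : (d 0 + d 1) / K ≤ periodicPartition R d 0 N := by
  have hκ0 := (norm_nonneg _).trans hR
  have hK0 : 0 < K := lt_of_lt_of_le (by positivity) hK
  have h := (periodicPartition_le_openPartition hd hc hR hκ hN 0).2
  have hp : 0 ≤ periodicPartition R d 0 N :=
    weightedTrace_nonneg (Conf.weight_pos hd 1) (rowTransfer_conserves hd hc 0) hN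
  rw [openPartition_zero] at h
  rw [div_le_iff₀' hK0]
  exact h.trans (mul_le_mul_of_nonneg_right hK hp)

/-- Opening one chain, cutting it and closing the two pieces takes four comparisons, each costing a
factor `K`. -/
theorem periodicPartition_mul (m n : ℕ) :
    periodicPartition R d (m + 1 + n) N ≤
        K ^ 4 * (periodicPartition R d n N * periodicPartition R d m N) ∧
      periodicPartition R d n N * periodicPartition R d m N ≤
        K ^ 4 * periodicPartition R d (m + 1 + n) N := by
  have hκ0 := (norm_nonneg _).trans hR
  have hK0 : 0 < K := lt_of_lt_of_le (by positivity) hK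
  have hp : ∀ n, 0 ≤ periodicPartition R d n N := fun n =>
    weightedTrace_nonneg (Conf.weight_pos hd (n + 1)) (rowTransfer_conserves hd hc n) hN
  have ho := openPartition_nonneg hd hc hR hκ hN
  have h1 : ∀ n, periodicPartition R d n N ≤ K * openPartition R d n N := fun n =>
    (periodicPartition_le_openPartition hd hc hR hκ hN n).1.trans
      (mul_le_mul_of_nonneg_right hK (ho n))
  have h2 : ∀ n, openPartition R d n N ≤ K * periodicPartition R d n N := fun n =>
    (periodicPartition_le_openPartition hd hc hR hκ hN n).2.trans
      (mul_le_mul_of_nonneg_right hK (hp n))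
  have h3 := (openPartition_mul hd hc hR hκ hN m n).1.trans
    (mul_le_mul_of_nonneg_right hK (mul_nonneg (ho n) (ho m)))
  have h4 := (openPartition_mul hd hc hR hκ hN m n).2.trans
    (mul_le_mul_of_nonneg_right hK (ho (m + 1 + n)))
  constructor
  · calc periodicPartition R d (m + 1 + n) N ≤ K * openPartition R d (m + 1 + n) N := h1 _
      _ ≤ K * (K * (openPartition R d n N * openPartition R d m N)) := by gcongr
      _ ≤ K * (K * ((K * periodicPartition R d n N) * (K * periodicPartition R d m N))) := by
        gcongr
        · exact ho m
        · exact mul_nonneg hK0.le (hp n)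
        · exact h2 n
        · exact h2 m
      _ = _ := by ring
  · calc periodicPartition R d n N * periodicPartition R d m N
        ≤ (K * openPartition R d n N) * (K * openPartition R d m N) :=
          mul_le_mul (h1 n) (h1 m) (hp m) (mul_nonneg hK0.le (ho n))
      _ = K * (K * (openPartition R d n N * openPartition R d m N)) := by ring
      _ ≤ K * (K * (K * (K * periodicPartition R d (m + 1 + n) N))) := by
        refine mul_le_mul_of_nonneg_left (mul_le_mul_of_nonneg_left ?_ hK0.le) hK0.le
        exact h4.trans (mul_le_mul_of_nonneg_left (h2 _) hK0.le)
      _ = _ := by ring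

end Partition

end XXZ

namespace XXZ

open Matrix Finset

/-! ### Evaluating a torus partition function by rows or by columns -/

section Duality

variable {K : Type*} [CommRing K] {ι : Type*} [Fintype ι] [DecidableEq ι]

theorem list_ofFn_prod_apply (n : ℕ) (A : Fin (n + 1) → Matrix ι ι K) (i j : ι) :
    (List.ofFn A).prod i j = ∑ s : Fin n → ι, ∏ r : Fin (n + 1),
      A r ((Fin.cons i s : Fin (n + 1) → ι) r) ((Fin.snoc s j : Fin (n + 1) → ι) r) := by
  induction n generalizing i with
  | zero => simp [List.ofFn_succ, Fin.snoc]
  | succ n ih =>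
    rw [List.ofFn_succ, List.prod_cons, mul_apply, ← (Fin.consEquiv fun _ => ι).sum_comp,
      Fintype.sum_prod_type]
    refine Finset.sum_congr rfl fun k _ => ?_
    rw [ih, Finset.mul_sum]
    refine Finset.sum_congr rfl fun s _ => ?_
    rw [Fin.prod_univ_succ (n := n + 1)]
    change _ = A 0 i ((Fin.snoc (Fin.cons k s : Fin (n + 1) → ι) j : Fin (n + 2) → ι) 0) *
      ∏ r : Fin (n + 1), A r.succ ((Fin.cons k s : Fin (n + 1) → ι) r)
        ((Fin.snoc (Fin.cons k s : Fin (n + 1) → ι) j : Fin (n + 2) → ι) r.succ)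
    have h : (Fin.snoc (Fin.cons k s : Fin (n + 1) → ι) j : Fin (n + 2) → ι) =
        Fin.cons k (Fin.snoc s j : Fin (n + 1) → ι) := (Fin.cons_snoc_eq_snoc_cons _ _ _).symm
    rw [h]
    rfl

theorem trace_list_ofFn_prod (n : ℕ) (A : Fin (n + 1) → Matrix ι ι K) :
    (List.ofFn A).prod.trace = ∑ s : Fin (n + 1) → ι, ∏ r, A r (s r) (s (r + 1)) := by
  rw [← (Fin.consEquiv fun _ => ι).sum_comp, Fintype.sum_prod_type, trace]
  refine Finset.sum_congr rfl fun i _ => ?_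
  rw [diag_apply, list_ofFn_prod_apply]
  refine Finset.sum_congr rfl fun s _ => Finset.prod_congr rfl fun r _ => ?_
  change _ = A r ((Fin.cons i s : Fin (n + 1) → ι) r) ((Fin.cons i s : Fin (n + 1) → ι) (r + 1))
  congr 1
  refine Fin.lastCases ?_ (fun r => ?_) r
  · rw [Fin.snoc_last, Fin.last_add_one, Fin.cons_zero]
  · rw [Fin.snoc_castSucc, Fin.coeSucc_eq_succ, Fin.cons_succ]

/-- The tensor product of a family of matrices. -/
noncomputable def tensor {L : ℕ} (A : Fin L → Matrix ι ι K) : Matrix (Fin L → ι) (Fin L → ι) K :=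
  Matrix.of fun x y => ∏ r, A r (x r) (y r)

theorem tensor_mul {L : ℕ} (A B : Fin L → Matrix ι ι K) :
    tensor (fun r => A r * B r) = tensor A * tensor B := by
  ext x y
  simp only [tensor, of_apply, mul_apply, Finset.prod_univ_sum, Fintype.piFinset_univ,
    Finset.prod_mul_distrib]

theorem tensor_one {L : ℕ} : tensor (fun _ : Fin L => (1 : Matrix ι ι K)) = 1 := by
  ext x y
  rw [tensor, of_apply]
  by_cases h : x = y
  · subst h; simp
  · obtain ⟨r, hr⟩ := Function.ne_iff.mp h
    rw [one_apply_ne h]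
    exact Finset.prod_eq_zero (Finset.mem_univ r) (one_apply_ne hr)

theorem trace_tensor {L : ℕ} (A : Fin L → Matrix ι ι K) :
    (tensor A).trace = ∏ r, (A r).trace := by
  simp only [trace, diag_apply, tensor, of_apply, Finset.prod_univ_sum, Fintype.piFinset_univ]

theorem tensor_list_prod {L : ℕ} {κ : Type*} (ks : List κ) (F : Fin L → κ → Matrix ι ι K) :
    tensor (fun r => (ks.map (F r)).prod) = (ks.map fun k => tensor fun r => F r k).prod := by
  induction ks with
  | nil => simpa using tensor_one
  | cons k ks ih => simp only [List.map_cons, List.prod_cons, tensor_mul, ih]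

theorem sum_list_ofFn_prod {β A : Type*} [Fintype β] [Ring A] {m : ℕ} (Φ : Fin m → β → A) :
    ∑ σ : Fin m → β, (List.ofFn fun k => Φ k (σ k)).prod = (List.ofFn fun k => ∑ b, Φ k b).prod := by
  have h := (MultilinearMap.mkPiAlgebraFin ℤ m A).map_sum (α := fun _ => β) Φ
  simpa only [MultilinearMap.mkPiAlgebraFin_apply] using h.symm

/-- The transfer matrix in the direction transverse to the rows, for the vertex weights `f`. -/
noncomputable def columnTransfer (f : ι → ι → Matrix ι ι K) (n : ℕ) :
    Matrix (Fin (n + 1) → ι) (Fin (n + 1) → ι) K :=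
  ∑ s : Fin (n + 1) → ι, tensor fun r => f (s r) (s (r + 1))

/-- The partition function on a torus may be evaluated row by row or column by column. -/
theorem trace_pow_eq_trace_columns {m : ℕ} (F : Fin m → ι → ι → Matrix ι ι K) (G : Matrix ι ι K)
    (n : ℕ) :
    ((Matrix.of fun s t : Fin m → ι =>
        ((List.ofFn fun k => F k (s k) (t k)).prod * G).trace) ^ (n + 1)).trace =
      ((List.ofFn fun k => columnTransfer (F k) n).prod *
        tensor fun _ : Fin (n + 1) => G).trace := by
  rw [← List.prod_replicate, ← List.ofFn_const, trace_list_ofFn_prod]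
  simp only [of_apply, columnTransfer]
  -- Both sides are now sums over one spin per line and column; `Equiv.piComm` exchanges the two
  -- indices, and for a fixed configuration the trace factorizes over the columns.
  rw [← sum_list_ofFn_prod (fun k (s : Fin (n + 1) → ι) => tensor fun r => F k (s r) (s (r + 1))),
    Finset.sum_mul, trace_sum, ← (Equiv.piComm fun _ _ => ι).sum_comp]
  refine Finset.sum_congr rfl fun σ _ => ?_
  rw [← trace_tensor, tensor_mul]
  congr 2
  have h := tensor_list_prod (List.finRange m)
    fun (r : Fin (n + 1)) k => F k (σ k r) (σ k (r + 1))
  simp only [← List.ofFn_eq_map] at h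
  exact h

/-- The operator on an auxiliary site `0` and the site `k + 1` given by the vertex weights `f`. -/
noncomputable def siteOp {m : ℕ} (k : Fin m) (f : ι → ι → Matrix ι ι K) :
    Matrix (Fin (m + 1) → ι) (Fin (m + 1) → ι) K :=
  Matrix.of fun s t => if ∀ j, j ≠ 0 → j ≠ k.succ → s j = t j then
    f (s k.succ) (t k.succ) (s 0) (t 0) else 0

theorem siteOp_list_prod {m : ℕ} (F : Fin m → ι → ι → Matrix ι ι K) (ks : List (Fin m))
    (hks : ks.Nodup) (s t : Fin (m + 1) → ι) :
    (ks.map fun k => siteOp k (F k)).prod s t =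
      if ∀ k, k ∉ ks → s k.succ = t k.succ then
        (ks.map fun k => F k (s k.succ) (t k.succ)).prod (s 0) (t 0) else 0 := by
  induction ks generalizing s with
  | nil =>
    simp only [List.map_nil, List.prod_nil, List.not_mem_nil, not_false_eq_true, true_imp_iff]
    by_cases h : ∀ k : Fin m, s k.succ = t k.succ
    · rw [if_pos h, one_apply, one_apply]
      refine if_congr ⟨fun h' => congrFun h' 0, fun h0 => funext fun j => ?_⟩ rfl rfl
      exact Fin.cases h0 h j
    · rw [if_neg h, one_apply_ne]
      rintro rfl
      exact h fun _ => rfl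
  | cons k ks ih =>
    obtain ⟨hk, hks⟩ := List.nodup_cons.mp hks
    rw [List.map_cons, List.prod_cons, mul_apply]
    -- Only these intermediate configurations contribute: the site `k` already carries its final
    -- spin, since no later factor acts on it, and only the auxiliary spin is free.
    set u : ι → Fin (m + 1) → ι :=
      fun x => Function.update (Function.update s k.succ (t k.succ)) 0 x with hu
    have hu0 : ∀ x, u x 0 = x := fun x => by simp [hu]
    have huk : ∀ x, u x k.succ = t k.succ := fun x => by
      simp [hu]
    have huj : ∀ x j, j ≠ 0 → j ≠ k.succ → u x j = s j := fun x j h1 h2 => by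
      simp [hu, Function.update_of_ne h1, Function.update_of_ne h2]
    have hinj : Function.Injective u := fun x y h => by
      rw [← hu0 x, h, hu0]
    rw [← Fintype.sum_of_injective u hinj
      (fun x => if ∀ j, j ∉ k :: ks → s j.succ = t j.succ then
        F k (s k.succ) (t k.succ) (s 0) x *
          (ks.map fun k => F k (s k.succ) (t k.succ)).prod x (t 0) else 0)]
    · split_ifs
      · rw [List.map_cons, List.prod_cons, mul_apply]
      · simp
    · intro v hv
      rw [ih hks, siteOp, of_apply]
      split_ifs with h1 h2
      · refine absurd ⟨v 0, funext fun j => ?_⟩ hv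
        by_cases hj0 : j = 0
        · rw [hj0, hu0]
        by_cases hjk : j = k.succ
        · rw [hjk, huk, h2 k hk]
        · rw [huj _ _ hj0 hjk, h1 j hj0 hjk]
      all_goals simp
    · intro x
      have hmap : (ks.map fun k => F k (u x k.succ) (t k.succ)) =
          ks.map fun k => F k (s k.succ) (t k.succ) := by
        refine List.map_congr_left fun j hj => ?_
        rw [huj x j.succ (Fin.succ_ne_zero j) fun h => hk (Fin.succ_injective _ h ▸ hj)]
      rw [ih hks, siteOp, of_apply, if_pos (fun j h1 h2 => (huj x j h1 h2).symm), hu0, huk, hmap,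
        mul_ite, mul_zero]
      refine if_congr ⟨fun h j hj => ?_, fun h j hj => ?_⟩ rfl rfl
      · by_cases hjk : j = k
        · rw [hjk, huk]
        · rw [huj x _ (Fin.succ_ne_zero j) fun h' => hjk (Fin.succ_injective _ h')]
          exact h j (by simp [hjk, hj])
      · have hjk : j ≠ k := fun h' => hj (by simp [h'])
        rw [← huj x _ (Fin.succ_ne_zero j) fun h' => hjk (Fin.succ_injective _ h')]
        exact h j fun h' => hj (by simp [h'])

end Duality

end XXZ

namespace XXZ

open Matrix Finset
open scoped Kronecker

/-- A configuration as a function on the sites. -/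
def Conf.equivFun : ∀ n, Conf n ≃ (Fin n → Fin 2)
  | 0 => Equiv.ofUnique Unit _
  | n + 1 => ((Equiv.refl (Fin 2)).prodCongr (Conf.equivFun n)).trans (Fin.consEquiv fun _ => Fin 2)

theorem Conf.equivFun_succ (n : ℕ) (i : Fin 2) (x : Conf n) :
    Conf.equivFun (n + 1) (i, x) = (Fin.cons i (Conf.equivFun n x) : Fin (n + 1) → Fin 2) := rfl

theorem Conf.weight_eq_prod (d : Fin 2 → ℝ) : ∀ n (x : Conf n),
    Conf.weight d n x = ∏ r, d (Conf.equivFun n x r)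
  | 0, _ => rfl
  | n + 1, (i, x) => by
    rw [Fin.prod_univ_succ, Conf.equivFun_succ]
    change d i * Conf.weight d n x = d i * ∏ r, d (Conf.equivFun n x r)
    rw [Conf.weight_eq_prod d n x]

/-! ### The row transfer matrix as a sum over vertex configurations -/

section RowTransfer

variable {R : Matrix (Fin 2 × Fin 2) (Fin 2 × Fin 2) ℝ}

/-- The shift grows by a flip on the left and the staircase by a gate on the right; together they
add one vertex to the monodromy matrix. -/
theorem flip_gate_mul_apply {α : Type*} [Fintype α] [DecidableEq α]
    (U S : Matrix (Fin 2 × α) (Fin 2 × α) ℝ) (s i t j : Fin 2) (x y : α) :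
    (gate α flip * ((1 : Matrix (Fin 2) (Fin 2) ℝ) ⊗ₖ U) *
      (((1 : Matrix (Fin 2) (Fin 2) ℝ) ⊗ₖ S) * gate α R)) (s, i, x) (t, j, y) =
      ∑ u, R (i, u) (t, j) * (U * S) (s, x) (u, y) := by
  have h1 : ∀ (M : Matrix (Fin 2 × Fin 2 × α) (Fin 2 × Fin 2 × α) ℝ) q,
      (gate α flip * M) (s, i, x) q = M (i, s, x) q := by
    intro M q
    rw [mul_apply, Finset.sum_eq_single (i, s, x)]
    · simp [gate_apply, flip]
    · rintro ⟨k, u, z⟩ - hb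
      rw [gate_apply]
      by_cases hz : x = z
      · subst hz
        have : ¬ (s, i) = (k, u).swap := fun h => hb (by
          simp only [Prod.swap_prod_mk, Prod.mk.injEq] at h
          rw [h.1, h.2])
        simp only [flip, of_apply, if_neg this, zero_mul]
      · rw [one_apply_ne hz, mul_zero, zero_mul]
    · simp
  rw [mul_assoc, ← mul_assoc (_ ⊗ₖ U), ← mul_kronecker_mul, one_mul, h1, mul_apply,
    Fintype.sum_prod_type, Finset.sum_eq_single i, Fintype.sum_prod_type]
  · refine Finset.sum_congr rfl fun u _ => ?_
    rw [Finset.sum_eq_single y]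
    · simp [gate_apply, mul_comm]
    · intro z _ hz
      simp [gate_apply, one_apply_ne hz]
    · simp
  · intro k _ hk
    refine Finset.sum_eq_zero fun q _ => ?_
    simp [one_apply_ne hk.symm]
  · simp

/-- The vertex weights as a matrix on the space transverse to the chain. -/
noncomputable def vertex (R : Matrix (Fin 2 × Fin 2) (Fin 2 × Fin 2) ℝ) (i j : Fin 2) :
    Matrix (Fin 2) (Fin 2) ℝ :=
  Matrix.of fun t u => R (i, u) (t, j)

theorem rowMonodromy_apply : ∀ (n : ℕ) (s t : Fin 2) (x y : Conf n),
    rowMonodromy R n (s, x) (t, y) =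
      (List.ofFn fun r => vertex R (Conf.equivFun n x r) (Conf.equivFun n y r)).prod t s
  | 0, s, t, (), () => by
    rw [rowMonodromy, shift, stair, one_mul, List.ofFn_zero, List.prod_nil, one_apply, one_apply]
    refine if_congr ⟨fun h => (congrArg Prod.fst h).symm, fun h => ?_⟩ rfl rfl
    rw [h]
  | n + 1, s, t, (i, x), (j, y) => by
    rw [List.ofFn_succ, List.prod_cons, mul_apply, Conf.equivFun_succ, Conf.equivFun_succ]
    simp only [Fin.cons_zero, Fin.cons_succ]
    refine (flip_gate_mul_apply (shift n) (stair R n) s i t j x y).trans ?_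
    refine Finset.sum_congr rfl fun u _ => ?_
    rw [← rowMonodromy_apply n]
    rfl

theorem rowTransfer_apply (n : ℕ) (p q : Conf (n + 1)) :
    rowTransfer R n p q = ∑ s : Fin (n + 1) → Fin 2, ∏ r,
      R (Conf.equivFun (n + 1) p r, s (r + 1)) (s r, Conf.equivFun (n + 1) q r) := by
  have h := trace_list_ofFn_prod n fun r =>
    vertex R (Conf.equivFun (n + 1) p r) (Conf.equivFun (n + 1) q r)
  simp only [vertex, of_apply] at h
  rw [← h]
  obtain ⟨i, x⟩ := p
  obtain ⟨j, y⟩ := q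
  rw [List.ofFn_succ, List.prod_cons, trace, Conf.equivFun_succ, Conf.equivFun_succ]
  simp only [Fin.cons_zero, Fin.cons_succ, diag_apply, mul_apply]
  change ∑ s, ∑ u, R (i, u) (s, j) * rowMonodromy R n (s, x) (u, y) = _
  simp only [rowMonodromy_apply, of_apply]
  rfl

end RowTransfer

/-! ### The quantum transfer matrix in vertex form -/

section TransferMatrix

variable {K : Type*} [CommRing K]

theorem prod_reverse_finRange_two_mul {M : Type*} [Monoid M] (N : ℕ) (g : Fin (2 * N) → M) :
    ((List.finRange (2 * N)).reverse.map g).prod =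
      ((List.finRange N).reverse.map fun l =>
        g ⟨2 * l.1 + 1, by omega⟩ * g ⟨2 * l.1, by omega⟩).prod := by
  rw [List.map_reverse, ← List.ofFn_eq_map, List.ofFn_mul', List.reverse_flatten, List.prod_flatten,
    List.map_reverse, List.map_map, List.ofFn_eq_map, List.map_map, List.map_reverse]
  congr 2
  refine List.map_congr_left fun l _ => ?_
  simp [List.ofFn_succ]

theorem map_reverse_finRange {M : Type*} {m : ℕ} (g : Fin m → M) :
    (List.finRange m).reverse.map g = List.ofFn fun k => g k.rev := by
  rw [List.finRange_reverse, List.map_map, List.ofFn_eq_map]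
  rfl

/-- Reversing the labels of the lines is a change of basis, so it leaves the trace unchanged. -/
theorem trace_pow_eq_trace_columns_reverse {m : ℕ}
    (F : Fin m → Fin 2 → Fin 2 → Matrix (Fin 2) (Fin 2) K) (G : Matrix (Fin 2) (Fin 2) K) (n : ℕ) :
    ((Matrix.of fun s t : Fin m → Fin 2 =>
        (((List.finRange m).reverse.map fun k => F k (s k) (t k)).prod * G).trace) ^
          (n + 1)).trace =
      (((List.finRange m).reverse.map fun k => columnTransfer (F k) n).prod *
        tensor fun _ : Fin (n + 1) => G).trace := by
  simp only [map_reverse_finRange]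
  rw [← trace_pow_eq_trace_columns (fun k => F k.rev), ← trace_submatrix_equiv _
    (Equiv.arrowCongr (Fin.revPerm (n := m)) (Equiv.refl (Fin 2))), ← submatrix_equiv_pow]
  congr 2
  ext s t
  simp [Equiv.arrowCongr]

theorem traceAux_mul_embedOne {m : ℕ} (P : Matrix (Fin (m + 1) → Fin 2) (Fin (m + 1) → Fin 2) ℂ)
    (G : Matrix (Fin 2) (Fin 2) ℂ) (s t : Fin m → Fin 2) :
    traceAux (P * embedOne 0 G) s t =
      ∑ i, ∑ x, P (Fin.cons i s : Fin (m + 1) → Fin 2) (Fin.cons x t : Fin (m + 1) → Fin 2) *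
        G x i := by
  rw [traceAux, of_apply]
  refine Finset.sum_congr rfl fun i _ => ?_
  rw [mul_apply, ← (Fin.consEquiv fun _ => Fin 2).sum_comp, Fintype.sum_prod_type]
  refine Finset.sum_congr rfl fun x _ => ?_
  rw [Finset.sum_eq_single t]
  · change _ * embedOne 0 G (Fin.cons x t : Fin (m + 1) → Fin 2)
      (Fin.cons i t : Fin (m + 1) → Fin 2) = _
    rw [embedOne, of_apply, if_pos]
    · rfl
    · intro k hk
      obtain ⟨k, rfl⟩ := Fin.exists_succ_eq.mpr hk
      rfl
  · intro u _ hu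
    change _ * embedOne 0 G (Fin.cons x u : Fin (m + 1) → Fin 2)
      (Fin.cons i t : Fin (m + 1) → Fin 2) = _
    rw [embedOne, of_apply, if_neg, mul_zero]
    intro h
    exact hu (funext fun k => h k.succ (Fin.succ_ne_zero k))
  · simp

theorem embedTwo_zero_succ {m : ℕ} (k : Fin m) (M : Matrix (Fin 2 × Fin 2) (Fin 2 × Fin 2) ℂ) :
    embedTwo 0 k.succ M = siteOp k fun s t => Matrix.of fun x y => M (x, s) (y, t) := rfl

theorem embedTwo_succ_zero {m : ℕ} (k : Fin m) (M : Matrix (Fin 2 × Fin 2) (Fin 2 × Fin 2) ℂ) :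
    embedTwo k.succ 0 M = siteOp k fun s t => Matrix.of fun x y => M (s, x) (t, y) := by
  ext s t
  simp only [embedTwo, siteOp, of_apply]
  exact if_congr ⟨fun h j h1 h2 => h j h2 h1, fun h j h1 h2 => h j h2 h1⟩ rfl rfl

/-- The vertex weights of the horizontal lines of the quantum transfer matrix. -/
noncomputable def lineWeight (M : Matrix (Fin 2 × Fin 2) (Fin 2 × Fin 2) ℂ) (N : ℕ) (k : Fin (2 * N))
    (s t : Fin 2) : Matrix (Fin 2) (Fin 2) ℂ :=
  if Even k.1 then Matrix.of fun x y => M (x, s) (y, t) else Matrix.of fun x y => M (t, x) (s, y)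

theorem trace_quantumTransferMatrix_pow (M : Matrix (Fin 2 × Fin 2) (Fin 2 × Fin 2) ℂ)
    (G : Matrix (Fin 2) (Fin 2) ℂ) (N n : ℕ) :
    ((traceAux (((List.finRange N).reverse.map fun l =>
      embedTwo (⟨2 * l.1 + 2, by omega⟩ : Fin (2 * N + 1)) ⟨0, by omega⟩ (transposeFst M) *
        embedTwo (⟨0, by omega⟩ : Fin (2 * N + 1)) ⟨2 * l.1 + 1, by omega⟩ M).prod *
      embedOne (⟨0, by omega⟩ : Fin (2 * N + 1)) G)) ^ (n + 1)).trace =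
    ((columnTransfer (fun s t => Matrix.of fun x y => M (t, x) (s, y)) n *
      columnTransfer (fun s t => Matrix.of fun x y => M (x, s) (y, t)) n) ^ N *
        tensor fun _ : Fin (n + 1) => G).trace := by
  have hprod : ((List.finRange N).reverse.map fun l =>
      embedTwo (⟨2 * l.1 + 2, by omega⟩ : Fin (2 * N + 1)) ⟨0, by omega⟩ (transposeFst M) *
        embedTwo (⟨0, by omega⟩ : Fin (2 * N + 1)) ⟨2 * l.1 + 1, by omega⟩ M).prod =
      ((List.finRange (2 * N)).reverse.map fun k => siteOp k (lineWeight M N k)).prod := by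
    rw [prod_reverse_finRange_two_mul]
    congr 2
    funext l
    congr 1
    · refine (embedTwo_succ_zero (⟨2 * l.1 + 1, by omega⟩ : Fin (2 * N)) _).trans ?_
      congr 1
      funext s t
      have : ¬ Even (2 * l.1 + 1) := by simp
      simp only [lineWeight, if_neg this]
      rfl
    · refine (embedTwo_zero_succ (⟨2 * l.1, by omega⟩ : Fin (2 * N)) _).trans ?_
      congr 1
      funext s t
      have : Even (2 * l.1) := by simp
      simp only [lineWeight, if_pos this]
  have hrow : traceAux (((List.finRange N).reverse.map fun l =>
      embedTwo (⟨2 * l.1 + 2, by omega⟩ : Fin (2 * N + 1)) ⟨0, by omega⟩ (transposeFst M) *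
        embedTwo (⟨0, by omega⟩ : Fin (2 * N + 1)) ⟨2 * l.1 + 1, by omega⟩ M).prod *
      embedOne (⟨0, by omega⟩ : Fin (2 * N + 1)) G) =
      Matrix.of fun s t : Fin (2 * N) → Fin 2 =>
        (((List.finRange (2 * N)).reverse.map fun k => lineWeight M N k (s k) (t k)).prod *
          G).trace := by
    ext s t
    rw [hprod]
    refine (traceAux_mul_embedOne _ G s t).trans ?_
    rw [of_apply, trace]
    refine Finset.sum_congr rfl fun i _ => ?_
    rw [diag_apply, mul_apply]
    refine Finset.sum_congr rfl fun x _ => ?_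
    rw [siteOp_list_prod _ _ (List.nodup_reverse.mpr (List.nodup_finRange _)), if_pos]
    · rfl
    · intro k hk
      simp at hk
  rw [hrow, trace_pow_eq_trace_columns_reverse, prod_reverse_finRange_two_mul]
  congr 2
  have : ∀ l : Fin N, columnTransfer (lineWeight M N ⟨2 * l.1 + 1, by omega⟩) n *
      columnTransfer (lineWeight M N ⟨2 * l.1, by omega⟩) n =
      columnTransfer (fun s t => Matrix.of fun x y => M (t, x) (s, y)) n *
      columnTransfer (fun s t => Matrix.of fun x y => M (x, s) (y, t)) n := by
    intro l
    congr 1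
    · congr 1
      funext s t
      have : ¬ Even (2 * l.1 + 1) := by simp
      simp only [lineWeight, if_neg this]
    · congr 1
      funext s t
      have : Even (2 * l.1) := by simp
      simp only [lineWeight, if_pos this]
  simp only [this, List.map_const', List.prod_replicate, List.length_reverse, List.length_finRange]

end TransferMatrix

end XXZ

namespace XXZ

/-! ### Quasi-additive sequences and exchange of limits -/

section QuasiAdditive

/-- Iterating the hypothesis puts `w (L M) / (L M)` within `K / L` of `w L / L` and, symmetrically,
within `K / M` of `w M / M`. The averages are therefore Cauchy, with a rate depending only on `K`.
-/
theorem exists_abs_div_sub_le {w : ℕ → ℝ} {K : ℝ}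
    (h : ∀ L M, 1 ≤ L → 1 ≤ M → |w (L + M) - w L - w M| ≤ K) :
    ∃ φ, ∀ L, 1 ≤ L → |w L / L - φ| ≤ K / L := by
  have hK : 0 ≤ K := (abs_nonneg _).trans (h 1 1 le_rfl le_rfl)
  have hmul : ∀ L, 1 ≤ L → ∀ M, 1 ≤ M → |w (L * M) - M * w L| ≤ M * K := by
    intro L hL M hM
    induction M, hM using Nat.le_induction with
    | base => simpa using hK
    | succ M hM ih =>
      have h1 := h (L * M) L (Nat.mul_pos hL hM) hL
      have h2 : w (L * (M + 1)) - (M + 1 : ℕ) * w L =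
          (w (L * M + L) - w (L * M) - w L) + (w (L * M) - M * w L) := by
        rw [mul_add, mul_one]; push_cast; ring
      rw [h2]
      refine (abs_add_le _ _).trans ((add_le_add h1 ih).trans (le_of_eq ?_))
      push_cast; ring
  have hdiv : ∀ L, 1 ≤ L → ∀ M, 1 ≤ M → |w (L * M) / (L * M) - w L / L| ≤ K / L := by
    intro L hL M hM
    have hL' : (0 : ℝ) < L := by exact_mod_cast hL
    have hM' : (0 : ℝ) < M := by exact_mod_cast hM
    have h1 : w (L * M) / (L * M) - w L / L = (w (L * M) - M * w L) / (L * M) := by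
      field_simp
    rw [h1, abs_div, abs_of_pos (mul_pos hL' hM'), div_le_iff₀ (mul_pos hL' hM')]
    refine (hmul L hL M hM).trans (le_of_eq ?_)
    field_simp
  have hcomp : ∀ L, 1 ≤ L → ∀ M, 1 ≤ M → |w L / L - w M / M| ≤ K / L + K / M := by
    intro L hL M hM
    have h1 := hdiv L hL M hM
    have h2 := hdiv M hM L hL
    rw [mul_comm M L, mul_comm (M : ℝ)] at h2
    rw [abs_le] at *
    constructor <;> linarith [h1.1, h1.2, h2.1, h2.2]
  have hcauchy : CauchySeq fun n : ℕ => w (n + 1) / ((n + 1 : ℕ) : ℝ) := by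
    refine cauchySeq_of_le_tendsto_0 (fun n : ℕ => 2 * K * (1 / ((n : ℝ) + 1))) ?_ ?_
    · intro n m N hn hm
      rw [Real.dist_eq]
      refine (hcomp (n + 1) (by omega) (m + 1) (by omega)).trans ?_
      have h1 : K / ((n + 1 : ℕ) : ℝ) ≤ K / ((N : ℝ) + 1) := by
        push_cast
        gcongr
      have h2 : K / ((m + 1 : ℕ) : ℝ) ≤ K / ((N : ℝ) + 1) := by
        push_cast
        gcongr
      refine (add_le_add h1 h2).trans (le_of_eq ?_)
      ring
    · simpa using tendsto_one_div_add_atTop_nhds_zero_nat.const_mul (2 * K)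
  obtain ⟨φ, hφ⟩ := cauchySeq_tendsto_of_complete hcauchy
  refine ⟨φ, fun L hL => ?_⟩
  have hlim : Tendsto (fun n : ℕ => K / L + K * (1 / ((n : ℝ) + 1))) atTop (𝓝 (K / L + K * 0)) :=
    (tendsto_one_div_add_atTop_nhds_zero_nat.const_mul K).const_add _
  rw [mul_zero, add_zero] at hlim
  refine le_of_tendsto_of_tendsto' ((tendsto_const_nhds.sub hφ).abs) hlim fun n => ?_
  refine (hcomp L hL (n + 1) (by omega)).trans (le_of_eq ?_)
  push_cast
  ring

theorem tendsto_of_abs_sub_le_div {s : ℕ → ℝ} {K φ : ℝ} (h : ∀ L, 1 ≤ L → |s L - φ| ≤ K / L) :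
    Tendsto s atTop (𝓝 φ) := by
  rw [tendsto_iff_dist_tendsto_zero]
  refine squeeze_zero' (Eventually.of_forall fun _ => dist_nonneg) ?_
    (tendsto_const_div_atTop_nhds_zero_nat K)
  filter_upwards [eventually_ge_atTop 1] with L hL
  rw [Real.dist_eq]
  exact h L hL

/-- For a family of sequences which is additive up to an error uniform in the parameter, the limit
in the parameter commutes with the limit of the averages. -/
theorem exists_tendsto_of_quasiAdditive {u : ℕ → ℕ → ℝ} {v : ℕ → ℝ} {K : ℝ}
    (hu : ∀ N, 1 ≤ N → ∀ L M, 1 ≤ L → 1 ≤ M → |u N (L + M) - u N L - u N M| ≤ K)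
    (hv : ∀ L, 1 ≤ L → Tendsto (fun N => u N L) atTop (𝓝 (v L))) :
    ∃ (z : ℕ → ℝ) (φ : ℝ), Tendsto (fun L : ℕ => v L / L) atTop (𝓝 φ) ∧
      (∀ N, 1 ≤ N → Tendsto (fun L : ℕ => u N L / L) atTop (𝓝 (z N))) ∧
      Tendsto z atTop (𝓝 φ) := by
  have hv' : ∀ L M, 1 ≤ L → 1 ≤ M → |v (L + M) - v L - v M| ≤ K := by
    intro L M hL hM
    refine le_of_tendsto ((((hv _ (by omega)).sub (hv L hL)).sub (hv M hM)).abs) ?_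
    filter_upwards [eventually_ge_atTop 1] with N hN
    exact hu N hN L M hL hM
  obtain ⟨φ, hφ⟩ := exists_abs_div_sub_le hv'
  have hz : ∀ N, ∃ z, 1 ≤ N → ∀ L, 1 ≤ L → |u N L / L - z| ≤ K / L := by
    intro N
    by_cases hN : 1 ≤ N
    · obtain ⟨z, hz⟩ := exists_abs_div_sub_le (hu N hN)
      exact ⟨z, fun _ => hz⟩
    · exact ⟨0, fun h => absurd h hN⟩
  choose z hz using hz
  refine ⟨z, φ, tendsto_of_abs_sub_le_div hφ, fun N hN => tendsto_of_abs_sub_le_div (hz N hN), ?_⟩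
  rw [Metric.tendsto_atTop]
  intro ε hε
  -- Since `K` does not depend on `N`, one `L` serves all `N`; only convergence in `N` at this `L`
  -- is then needed.
  obtain ⟨L, hL1, hL⟩ : ∃ L : ℕ, 1 ≤ L ∧ K / L < ε / 3 := by
    have h := (tendsto_const_div_atTop_nhds_zero_nat K).eventually_lt_const
      (show (0 : ℝ) < ε / 3 by linarith)
    obtain ⟨L, hL, hL1⟩ := (h.and (eventually_ge_atTop 1)).exists
    exact ⟨L, hL1, hL⟩
  have h1 : ∀ᶠ N in atTop, |u N L / L - v L / L| < ε / 3 := by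
    have := ((hv L hL1).div_const (L : ℝ))
    rw [Metric.tendsto_nhds] at this
    exact this (ε / 3) (by linarith)
  obtain ⟨N₀, hN₀⟩ := eventually_atTop.mp h1
  refine ⟨max N₀ 1, fun N hN => ?_⟩
  have h2 := hN₀ N (le_of_max_le_left hN)
  have h3 := hz N (le_of_max_le_right hN) L hL1
  have h4 := hφ L hL1
  rw [Real.dist_eq]
  rw [abs_lt] at *
  rw [abs_le] at h3 h4
  constructor <;> linarith [h2.1, h2.2, h3.1, h3.2, h4.1, h4.2]

end QuasiAdditive

/-! ### Powers converging to an exponential -/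

section ExpLimit

variable {𝔸 : Type*} [NormedRing 𝔸] [NormedAlgebra ℝ 𝔸] [CompleteSpace 𝔸]

theorem norm_pow_sub_pow_le {a b : 𝔸} {r : ℝ} (hr : 1 ≤ r) (ha : ‖a‖ ≤ r) (hb : ‖b‖ ≤ r) (N : ℕ) :
    ‖a ^ N - b ^ N‖ ≤ N * r ^ N * ‖a - b‖ := by
  have hpow : ∀ N, ‖b ^ (N + 1)‖ ≤ r ^ (N + 1) := fun N =>
    (norm_pow_le' b (Nat.succ_pos N)).trans (pow_le_pow_left₀ (norm_nonneg _) hb _)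
  induction N with
  | zero => simp
  | succ N ih =>
    have h1 : a ^ (N + 1) - b ^ (N + 1) = a * (a ^ N - b ^ N) + (a - b) * b ^ N := by
      rw [pow_succ', pow_succ', mul_sub, sub_mul]; abel
    have h2 : ‖(a - b) * b ^ N‖ ≤ r ^ (N + 1) * ‖a - b‖ := by
      cases N with
      | zero =>
        rw [pow_zero, mul_one, zero_add, pow_one]
        exact le_mul_of_one_le_left (norm_nonneg _) hr
      | succ N =>
        rw [mul_comm (r ^ _)]
        refine (norm_mul_le _ _).trans (mul_le_mul_of_nonneg_left ((hpow N).trans ?_)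
          (norm_nonneg _))
        exact pow_le_pow_right₀ hr (Nat.le_succ _)
    have h3 : ‖a * (a ^ N - b ^ N)‖ ≤ r * (N * r ^ N * ‖a - b‖) :=
      (norm_mul_le _ _).trans (mul_le_mul ha ih (norm_nonneg _) (zero_le_one.trans hr))
    rw [h1]
    refine (norm_add_le _ _).trans ((add_le_add h3 h2).trans (le_of_eq ?_))
    push_cast
    ring

theorem tendsto_nsmul_sub_of_hasDerivAt {f : ℝ → 𝔸} {a : 𝔸} (hf : HasDerivAt f a 0) :
    Tendsto (fun N : ℕ => (N : ℝ) • (f ((N : ℝ)⁻¹) - f 0)) atTop (𝓝 a) := by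
  have h1 : Tendsto (fun N : ℕ => ((N : ℝ)⁻¹)) atTop (𝓝[≠] 0) := by
    refine tendsto_nhdsWithin_iff.mpr ⟨tendsto_inv_atTop_nhds_zero_nat, ?_⟩
    filter_upwards [eventually_ge_atTop 1] with N hN
    have : (N : ℝ) ≠ 0 := by exact_mod_cast (by omega : N ≠ 0)
    simpa using this
  refine ((hasDerivAt_iff_tendsto_slope_zero.mp hf).comp h1).congr fun N => ?_
  simp

/-- If `f 0 = 1` then `f (1 / N) ^ N` converges to the exponential of the derivative. -/
theorem tendsto_pow_of_hasDerivAt {f : ℝ → 𝔸} {a : 𝔸} (h1 : ‖(1 : 𝔸)‖ ≤ 1) (hf : HasDerivAt f a 0)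
    (h0 : f 0 = 1) : ∃ b, Tendsto (fun N : ℕ => f ((N : ℝ)⁻¹) ^ N) atTop (𝓝 b) := by
  let _ : NormedAlgebra ℚ 𝔸 := NormedAlgebra.restrictScalars ℚ ℝ 𝔸
  set g : ℝ → 𝔸 := fun t => NormedSpace.exp (t • a) with hg
  have hg0 : g 0 = 1 := by simp [hg]
  have hgd : HasDerivAt g a 0 := by
    have := hasDerivAt_exp_smul_const (𝕂 := ℝ) a (0 : ℝ)
    simpa [hg] using this
  have hlim : ∀ k : ℝ → 𝔸, HasDerivAt k a 0 → k 0 = 1 →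
      ∀ᶠ N : ℕ in atTop, ‖k ((N : ℝ)⁻¹)‖ ≤ 1 + (‖a‖ + 1) / N := by
    intro k hk hk0
    have h2 := (tendsto_nsmul_sub_of_hasDerivAt hk).norm.eventually_lt_const (lt_add_one ‖a‖)
    filter_upwards [h2, eventually_ge_atTop 1] with N hN hN1
    have hN' : (0 : ℝ) < N := by exact_mod_cast hN1
    rw [norm_smul, Real.norm_of_nonneg hN'.le, hk0, mul_comm, ← lt_div_iff₀ hN'] at hN
    have h3 : ‖k ((N : ℝ)⁻¹)‖ ≤ ‖(1 : 𝔸)‖ + ‖k ((N : ℝ)⁻¹) - 1‖ := by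
      conv_lhs => rw [← add_sub_cancel (1 : 𝔸) (k ((N : ℝ)⁻¹))]
      exact norm_add_le _ _
    linarith
  refine ⟨NormedSpace.exp a, ?_⟩
  rw [tendsto_iff_norm_sub_tendsto_zero]
  -- As `f` and `g` agree to first order at `0`, `N ‖f (1/N) - g (1/N)‖` tends to zero, while the
  -- powers of the norm bound stay below `exp (‖a‖ + 1)`.
  have hD := ((tendsto_nsmul_sub_of_hasDerivAt hf).sub
    (tendsto_nsmul_sub_of_hasDerivAt hgd)).norm.const_mul (Real.exp (‖a‖ + 1))
  rw [sub_self, norm_zero, mul_zero] at hD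
  refine squeeze_zero' (Eventually.of_forall fun _ => norm_nonneg _) ?_ hD
  filter_upwards [hlim f hf h0, hlim g hgd hg0, eventually_ge_atTop 1] with N hfN hgN hN1
  have hN' : (0 : ℝ) < N := by exact_mod_cast hN1
  have hexp : NormedSpace.exp a = g ((N : ℝ)⁻¹) ^ N := by
    rw [hg, ← NormedSpace.exp_nsmul, ← Nat.cast_smul_eq_nsmul ℝ, smul_smul,
      mul_inv_cancel₀ hN'.ne', one_smul]
  have hr : (1 : ℝ) ≤ 1 + (‖a‖ + 1) / N := by
    have : 0 ≤ (‖a‖ + 1) / N := by positivity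
    linarith
  have hrN : (1 + (‖a‖ + 1) / N) ^ N ≤ Real.exp (‖a‖ + 1) := by
    have he : 1 + (‖a‖ + 1) / N ≤ Real.exp ((‖a‖ + 1) / N) := by
      rw [add_comm]
      exact Real.add_one_le_exp _
    refine (pow_le_pow_left₀ (zero_le_one.trans hr) he N).trans (le_of_eq ?_)
    rw [← Real.exp_nat_mul, mul_div_cancel₀ _ hN'.ne']
  rw [hexp]
  refine (norm_pow_sub_pow_le hr hfN hgN N).trans ?_
  rw [h0, hg0, ← smul_sub, norm_smul, Real.norm_of_nonneg hN'.le, sub_sub_sub_cancel_right]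
  calc (N : ℝ) * (1 + (‖a‖ + 1) / N) ^ N * ‖f ((N : ℝ)⁻¹) - g ((N : ℝ)⁻¹)‖
      = (1 + (‖a‖ + 1) / N) ^ N * (N * ‖f ((N : ℝ)⁻¹) - g ((N : ℝ)⁻¹)‖) := by ring
    _ ≤ _ := mul_le_mul_of_nonneg_right hrN (by positivity)

end ExpLimit

end XXZ

namespace XXZ

open Matrix Finset
open scoped Kronecker Matrix.Norms.L2Operator

/-! ### The real braid form of the weights -/

section Braid

/-- The real braid form of the `R`-matrix at spectral parameter `iε`. -/
noncomputable def braid (ζ ε : ℝ) : Matrix (Fin 2 × Fin 2) (Fin 2 × Fin 2) ℝ :=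
  Matrix.of fun p q =>
    if p = q then (if p.1 = p.2 then Real.sin (ζ - ε) / Real.sin ζ else 1)
    else if p = q.swap then -(Real.sin ε / Real.sin ζ) else 0

/-- At an imaginary spectral parameter every hyperbolic sine is `i` times a real sine, and the
common `i` cancels. The swap turns the permutation matrix at `ε = 0` into the identity. -/
theorem rMatrix_eq_braid {ζ : ℝ} (hζ : Real.sin ζ ≠ 0) (ε : ℝ) (p q : Fin 2 × Fin 2) :
    rMatrix (eta ζ) (Complex.I * ε) p q = (braid ζ ε p.swap q : ℂ) := by
  have h1 : Complex.sinh (eta ζ) = -(Complex.sin ζ * Complex.I) := by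
    rw [← Complex.sinh_mul_I, ← Complex.sinh_neg, eta]; congr 1; ring
  have h2 : Complex.sinh (eta ζ + Complex.I * ε) = -(Complex.sin (ζ - ε) * Complex.I) := by
    rw [← Complex.sinh_mul_I, ← Complex.sinh_neg, eta]; congr 1; ring
  have h3 : Complex.sinh (Complex.I * ε) = Complex.sin ε * Complex.I := by
    rw [← Complex.sinh_mul_I, mul_comm]
  have hζ' : Complex.sin ζ ≠ 0 := by exact_mod_cast hζ
  have hI := Complex.I_ne_zero
  obtain ⟨i, j⟩ := p
  obtain ⟨k, l⟩ := q
  simp only [rMatrix, braid, Matrix.smul_apply, of_apply, h1, h2, h3, smul_eq_mul, Prod.swap_prod_mk,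
    Prod.mk.injEq]
  fin_cases i <;> fin_cases j <;> fin_cases k <;> fin_cases l <;> simp <;> field_simp <;>
    simp [Complex.I_sq]

theorem braid_symm (ζ ε : ℝ) (p q : Fin 2 × Fin 2) : braid ζ ε p q = braid ζ ε q p := by
  obtain ⟨i, j⟩ := p
  obtain ⟨k, l⟩ := q
  fin_cases i <;> fin_cases j <;> fin_cases k <;> fin_cases l <;> rfl

theorem braid_conserves (ζ ε : ℝ) (d : Fin 2 → ℝ) :
    Conserves (braid ζ ε) fun p => d p.1 * d p.2 := by
  intro p q h
  by_cases h1 : p = q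
  · rw [h1]
  by_cases h2 : p = q.swap
  · rw [h2]; exact mul_comm _ _
  · exact absurd (by simp [braid, h1, h2]) h

theorem braid_zero {ζ : ℝ} (hζ : Real.sin ζ ≠ 0) : braid ζ 0 = 1 := by
  ext p q
  simp [braid, one_apply, div_self hζ]

/-- Four entries of the difference can be nonzero, each at most `|ε| / sin ζ` because the sine is
1-Lipschitz. -/
theorem norm_braid_sub_one_le {ζ : ℝ} (hζ : 0 < Real.sin ζ) (ε : ℝ) :
    ‖braid ζ ε - 1‖ ≤ 4 * (|ε| / Real.sin ζ) := by
  have ha : |Real.sin (ζ - ε) / Real.sin ζ - 1| ≤ |ε| / Real.sin ζ := by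
    rw [div_sub_one hζ.ne', abs_div, abs_of_pos hζ]
    refine div_le_div_of_nonneg_right ?_ hζ.le
    refine (Real.abs_sin_sub_sin_le _ _).trans (le_of_eq ?_)
    rw [sub_sub_cancel_left, abs_neg]
  have hb : |Real.sin ε / Real.sin ζ| ≤ |ε| / Real.sin ζ := by
    rw [abs_div, abs_of_pos hζ]
    exact div_le_div_of_nonneg_right Real.abs_sin_le_abs hζ.le
  refine (norm_le_sum_abs _).trans ?_
  simp [Fintype.sum_prod_type, Fin.sum_univ_two, braid, Prod.swap]
  linarith

end Braid

/-! ### The trace as a periodic partition function -/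

section TracePow

/-- Cyclicity of the trace moves the leading `A` to the end, past the weight with which it commutes.
-/
theorem trace_pow_mul_transpose_eq {n : Type*} [Fintype n] [DecidableEq n] {A : Matrix n n ℝ}
    {d : n → ℝ} (hA : Conserves A d) (N : ℕ) :
    ((A * Aᵀ) ^ N * diagonal d).trace = weightedTrace A d N := by
  cases N with
  | zero => rw [weightedTrace, pow_zero, pow_zero]
  | succ N =>
    have h : ∀ N, (A * Aᵀ) ^ N * A = A * (Aᵀ * A) ^ N := by
      intro N
      induction N with
      | zero => simp
      | succ N ih => rw [pow_succ, mul_assoc, mul_assoc, ← mul_assoc, ih, mul_assoc, ← pow_succ]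
    rw [weightedTrace, pow_succ, ← mul_assoc, h, mul_assoc, mul_assoc, trace_mul_comm, mul_assoc,
      mul_assoc, ← hA.commute, pow_succ, mul_assoc, mul_assoc]

theorem trace_map_ofReal {n : Type*} [Fintype n] [DecidableEq n] (A : Matrix n n ℝ) :
    (Complex.ofRealHom.mapMatrix A).trace = (A.trace : ℂ) := by
  simp [trace]

theorem columnTransfer_apply {K ι : Type*} [CommRing K] [Fintype ι] [DecidableEq ι]
    (f : ι → ι → Matrix ι ι K) (n : ℕ) (x y : Fin (n + 1) → ι) :
    columnTransfer f n x y = ∑ s : Fin (n + 1) → ι, ∏ r, f (s r) (s (r + 1)) (x r) (y r) := by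
  simp only [columnTransfer, Matrix.sum_apply, tensor, of_apply]

/-- The magnetic weights of the two spin directions. -/
noncomputable def fieldWeight (c : ℝ) : Fin 2 → ℝ := ![Real.exp c, Real.exp (-c)]

theorem fieldWeight_pos (c : ℝ) (i : Fin 2) : 0 < fieldWeight c i := by
  fin_cases i <;> exact Real.exp_pos _

/-- Here `-ℵ/N = iε` with `ε` real. The partially transposed lines give `A`; the others give `Aᵀ`,
because the braid form is symmetric. -/
theorem tracePow_eq {ζ : ℝ} (hζ : Real.sin ζ ≠ 0) (J h T : ℝ) (N n : ℕ) :
    tracePow J h ζ T N (n + 1) =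
      (periodicPartition (braid ζ (J / T * Real.sin ζ * (N : ℝ)⁻¹)) (fieldWeight (h / (2 * T))) n N :
        ℂ) := by
  set ε := J / T * Real.sin ζ * (N : ℝ)⁻¹ with hε
  have hal : aleph J ζ T / (N : ℂ) = -(Complex.I * ε) := by
    have h1 : Complex.sinh (eta ζ) = -(Complex.sin ζ * Complex.I) := by
      rw [← Complex.sinh_mul_I, ← Complex.sinh_neg, eta]; congr 1; ring
    rw [aleph, h1, hε]
    push_cast
    rw [div_eq_mul_inv]
    ring
  have e1 : -(aleph J ζ T / (N : ℂ)) - 0 = Complex.I * ε := by rw [hal]; ring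
  have e2 : 0 - aleph J ζ T / (N : ℂ) = Complex.I * ε := by rw [hal]; ring
  rw [tracePow, quantumTransferMatrix, monodromy, e1, e2, trace_quantumTransferMatrix_pow]
  set e := Conf.equivFun (n + 1) with he
  obtain ⟨A, hA⟩ : ∃ A : Matrix (Conf (n + 1)) (Conf (n + 1)) ℝ, A = rowTransfer (braid ζ ε) n :=
    ⟨_, rfl⟩
  have hA_apply : ∀ p q, A p q = ∑ s : Fin (n + 1) → Fin 2, ∏ r,
      braid ζ ε (e p r, s (r + 1)) (s r, e q r) := fun p q => hA ▸ rowTransfer_apply n p q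
  set d := fieldWeight (h / (2 * T)) with hd
  have hodd : columnTransfer (fun s t => Matrix.of fun x y =>
      rMatrix (eta ζ) (Complex.I * ε) (t, x) (s, y)) n =
      (Complex.ofRealHom.mapMatrix A).submatrix e.symm e.symm := by
    ext x y
    rw [columnTransfer_apply, submatrix_apply, RingHom.mapMatrix_apply, map_apply, hA_apply, map_sum]
    simp only [map_prod, Equiv.apply_symm_apply, of_apply, rMatrix_eq_braid hζ, Prod.swap_prod_mk]
    rfl
  have heven : columnTransfer (fun s t => Matrix.of fun x y =>
      rMatrix (eta ζ) (Complex.I * ε) (x, s) (y, t)) n =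
      (Complex.ofRealHom.mapMatrix Aᵀ).submatrix e.symm e.symm := by
    ext x y
    rw [columnTransfer_apply, submatrix_apply, RingHom.mapMatrix_apply, map_apply, transpose_apply,
      hA_apply, map_sum]
    simp only [map_prod, Equiv.apply_symm_apply, of_apply, rMatrix_eq_braid hζ, Prod.swap_prod_mk]
    simp only [braid_symm ζ ε (_, x _)]
    rfl
  have htensor : (tensor fun _ : Fin (n + 1) => expSigmaZ (h / (2 * T))) =
      (Complex.ofRealHom.mapMatrix (diagonal (Conf.weight d (n + 1)))).submatrix e.symm e.symm := by
    ext x y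
    rw [submatrix_apply, RingHom.mapMatrix_apply, map_apply, tensor, of_apply]
    by_cases hxy : x = y
    · subst hxy
      rw [diagonal_apply_eq, Conf.weight_eq_prod, map_prod]
      refine Finset.prod_congr rfl fun r _ => ?_
      rw [← he, Equiv.apply_symm_apply, expSigmaZ, diagonal_apply_eq, hd, fieldWeight]
      generalize x r = i
      fin_cases i <;> simp
    · rw [diagonal_apply_ne _ (fun h => hxy (e.symm.injective h)), map_zero]
      obtain ⟨r, hr⟩ := Function.ne_iff.mp hxy
      exact Finset.prod_eq_zero (Finset.mem_univ r) (diagonal_apply_ne _ hr)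
  rw [hodd, heven, htensor, submatrix_mul_equiv, submatrix_equiv_pow, submatrix_mul_equiv,
    trace_submatrix_equiv, ← map_mul, ← map_pow, ← map_mul, trace_map_ofReal]
  have hcons : Conserves A (Conf.weight d (n + 1)) :=
    hA ▸ rowTransfer_conserves (fieldWeight_pos _) (braid_conserves ζ ε d) n
  rw [trace_pow_mul_transpose_eq hcons, hA]
  rfl

end TracePow

end XXZ

namespace XXZ

open Matrix Finset
open scoped Kronecker Matrix.Norms.L2Operator

/-! ### The Trotter limit at fixed length -/

section TrotterLimit

variable {n m : Type*} [Fintype n] [DecidableEq n] [Fintype m] [DecidableEq m]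

/-- All entries are differentiable functions of the parameter. -/
def EntryDifferentiable (A : ℝ → Matrix n n ℝ) : Prop :=
  ∀ x y, Differentiable ℝ fun t => A t x y

theorem EntryDifferentiable.const (A : Matrix n n ℝ) : EntryDifferentiable fun _ => A :=
  fun _ _ => differentiable_const _

theorem EntryDifferentiable.mul {A B : ℝ → Matrix n n ℝ} (hA : EntryDifferentiable A)
    (hB : EntryDifferentiable B) : EntryDifferentiable fun t => A t * B t := by
  intro x y
  simp only [mul_apply]
  exact Differentiable.fun_sum fun k _ => (hA x k).mul (hB k y)

theorem EntryDifferentiable.transpose {A : ℝ → Matrix n n ℝ} (hA : EntryDifferentiable A) :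
    EntryDifferentiable fun t => (A t)ᵀ :=
  fun x y => hA y x

theorem EntryDifferentiable.kronecker {A : ℝ → Matrix n n ℝ} {B : ℝ → Matrix m m ℝ}
    (hA : EntryDifferentiable A) (hB : EntryDifferentiable B) :
    EntryDifferentiable fun t => A t ⊗ₖ B t :=
  fun x y => (hA x.1 y.1).mul (hB x.2 y.2)

theorem EntryDifferentiable.gate {X : ℝ → Matrix (Fin 2 × Fin 2) (Fin 2 × Fin 2) ℝ}
    (hX : EntryDifferentiable X) : EntryDifferentiable fun t => gate n (X t) :=
  fun x y => (hX (x.1, x.2.1) (y.1, y.2.1)).mul (differentiable_const _)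

theorem EntryDifferentiable.exists_hasDerivAt {A : ℝ → Matrix n n ℝ} (hA : EntryDifferentiable A)
    (t : ℝ) : ∃ B, HasDerivAt A B t := by
  have h : A = fun t => ∑ i, ∑ j, A t i j • Matrix.single i j (1 : ℝ) := by
    funext t
    conv_lhs => rw [matrix_eq_sum_single (A t)]
    simp
  rw [h]
  exact ⟨_, (DifferentiableAt.fun_sum fun i _ => DifferentiableAt.fun_sum fun j _ =>
    ((hA i j) t).smul_const _).hasDerivAt⟩

variable {R : ℝ → Matrix (Fin 2 × Fin 2) (Fin 2 × Fin 2) ℝ}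

theorem stair_entryDifferentiable (hR : EntryDifferentiable R) :
    ∀ n, EntryDifferentiable fun t => stair (R t) n
  | 0 => EntryDifferentiable.const _
  | n + 1 => ((EntryDifferentiable.const _).kronecker (stair_entryDifferentiable hR n)).mul hR.gate

theorem rowTransfer_entryDifferentiable (hR : EntryDifferentiable R) (n : ℕ) :
    EntryDifferentiable fun t => rowTransfer (R t) n := by
  intro x y
  change Differentiable ℝ fun t => ∑ s, ∑ u, R t (x.1, u) (s, y.1) *
    (shift n * stair (R t) n) (s, x.2) (u, y.2)
  exact Differentiable.fun_sum fun s _ => Differentiable.fun_sum fun u _ => (hR _ _).mul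
    (((EntryDifferentiable.const (shift n)).mul (stair_entryDifferentiable hR n)) _ _)

theorem stair_one : ∀ n, stair 1 n = 1
  | 0 => rfl
  | n + 1 => by
    have h : ∀ {α : Type} [Fintype α] [DecidableEq α] (S : Matrix (Fin 2 × α) (Fin 2 × α) ℝ),
        S = 1 → ((1 : Matrix (Fin 2) (Fin 2) ℝ) ⊗ₖ S) * gate α 1 = 1 := by
      rintro α _ _ S rfl
      rw [gate_one, one_kronecker_one, one_mul]
    exact h _ (stair_one n)

theorem rowTransfer_one_transpose_mul_self (n : ℕ) :
    (rowTransfer 1 n)ᵀ * rowTransfer 1 n = 1 := by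
  obtain ⟨Y, hY, hYn⟩ := exists_rowTransfer_eq (R := 1) (by simp) n
  have hY0 : Y = 0 := by simpa using hYn
  rw [hY, hY0, add_zero, one_mul, stair_one, mul_one, shift_transpose_mul_self]

theorem braid_entryDifferentiable (ζ c : ℝ) : EntryDifferentiable fun t => braid ζ (c * t) := by
  intro p q
  simp only [braid, of_apply]
  split_ifs <;> fun_prop

/-- As a function of `t = 1/N`, the matrix `Aᵀ A` is differentiable and equals `1` at `t = 0`, where
`A` is orthogonal; its `N`-th power thus has a limit. -/
theorem exists_tendsto_periodicPartition {ζ : ℝ} (hζ : Real.sin ζ ≠ 0) (c : ℝ) (d : Fin 2 → ℝ)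
    (n : ℕ) : ∃ b, Tendsto (fun N : ℕ => periodicPartition (braid ζ (c * (N : ℝ)⁻¹)) d n N) atTop
      (𝓝 b) := by
  have : CompleteSpace (Matrix (Fin 2 × Conf n) (Fin 2 × Conf n) ℝ) :=
    FiniteDimensional.complete ℝ _
  have hT := rowTransfer_entryDifferentiable (braid_entryDifferentiable ζ c) n
  obtain ⟨B, hB⟩ := (hT.transpose.mul hT).exists_hasDerivAt 0
  obtain ⟨b, hb⟩ := tendsto_pow_of_hasDerivAt (norm_le_one_of_transpose_mul_self (by simp)) hB
    (by rw [mul_zero, braid_zero hζ, rowTransfer_one_transpose_mul_self])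
  refine ⟨(b * diagonal fun p : Fin 2 × Conf n => Conf.weight d (n + 1) p).trace, ?_⟩
  have hcont : Continuous fun X : Matrix (Fin 2 × Conf n) (Fin 2 × Conf n) ℝ =>
      (X * diagonal fun p : Fin 2 × Conf n => Conf.weight d (n + 1) p).trace :=
    (continuous_id.matrix_mul continuous_const).matrix_trace
  exact (hcont.tendsto b).comp hb

end TrotterLimit

/-! ### Numerical bounds at high temperature -/

section Bounds

variable {J ζ T : ℝ} (hJ : 0 < J) (hζ : 0 < Real.sin ζ) (hT : 128 * J ≤ T)
include hJ hζ hT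

theorem norm_braid_sub_one_le_div {N : ℕ} (hN : 1 ≤ N) :
    ‖braid ζ (J / T * Real.sin ζ * (N : ℝ)⁻¹) - 1‖ ≤ 4 * (J / (T * N)) := by
  have hT0 : 0 < T := by linarith
  have hN0 : (0 : ℝ) < N := by exact_mod_cast hN
  refine (norm_braid_sub_one_le hζ _).trans (le_of_eq ?_)
  rw [abs_of_pos (by positivity)]
  field_simp

theorem four_mul_div_le {N : ℕ} (hN : 1 ≤ N) : 4 * (J / (T * N)) ≤ 1 / 32 := by
  have hT0 : 0 < T := by linarith
  have hN0 : (1 : ℝ) ≤ N := by exact_mod_cast hN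
  rw [mul_div_assoc', div_le_iff₀ (by positivity)]
  nlinarith

theorem pow_le_exp {N : ℕ} (hN : 1 ≤ N) :
    ((1 + 16 * (4 * (J / (T * N)))) ^ 2) ^ N ≤ Real.exp (128 * (J / T)) := by
  have hT0 : 0 < T := by linarith
  have hN0 : (0 : ℝ) < N := by exact_mod_cast hN
  have h1 : 1 + 16 * (4 * (J / (T * N))) ≤ Real.exp (16 * (4 * (J / (T * N)))) := by
    rw [add_comm]
    exact Real.add_one_le_exp _
  rw [← pow_mul]
  refine (pow_le_pow_left₀ (by positivity) h1 _).trans (le_of_eq ?_)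
  rw [← Real.exp_nat_mul]
  congr 1
  push_cast
  field_simp
  ring

end Bounds

end XXZ

/-- Commutativity of the Trotter limit `N → ∞` and the thermodynamic limit `L → ∞` for
`(1 / L) ln tr [t_q ^ L]` at high temperature. All the traces are positive reals, so that the
logarithms are the ordinary ones; both inner limits (to `α L` and `z N`) and both outer limits
exist, and the outer limits agree. -/
theorem theorem3p1 (J h ζ : ℝ) (hJ : 0 < J) (hh : 0 < h) (hζ : ζ ∈ Set.Ioo 0 Real.pi) :
    ∃ T₀ : ℝ, 0 < T₀ ∧ ∀ T : ℝ, T₀ ≤ T →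
      (∀ N L : ℕ, 1 ≤ N → 1 ≤ L →
        0 < (XXZ.tracePow J h ζ T N L).re ∧ (XXZ.tracePow J h ζ T N L).im = 0) ∧
      ∃ (α z : ℕ → ℝ) (φ : ℝ),
        (∀ L : ℕ, 1 ≤ L → Tendsto (fun N : ℕ => XXZ.tau J h ζ T N L) atTop (𝓝 (α L : ℂ))) ∧
        Tendsto α atTop (𝓝 φ) ∧
        (∀ N : ℕ, 1 ≤ N → Tendsto (fun L : ℕ => XXZ.tau J h ζ T N L) atTop (𝓝 (z N : ℂ))) ∧
        Tendsto z atTop (𝓝 φ) := by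
  -- This threshold makes `4 J / (T N) ≤ 1/32` for all `N ≥ 1`, as the transport argument requires.
  refine ⟨128 * J, by positivity, fun T hT => ?_⟩
  have hsin : 0 < Real.sin ζ := Real.sin_pos_of_mem_Ioo hζ
  set d := XXZ.fieldWeight (h / (2 * T)) with hd_def
  have hd : ∀ i, 0 < d i := XXZ.fieldWeight_pos _
  set K := Real.exp (128 * (J / T)) with hK_def
  have hK0 : 0 < K := Real.exp_pos _
  -- The index `n` stands for `n + 1` sites, hence the shifts `L - 1` below.
  set Z : ℕ → ℕ → ℝ := fun N n =>
    XXZ.periodicPartition (XXZ.braid ζ (J / T * Real.sin ζ * (N : ℝ)⁻¹)) d n N with hZ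
  have htr : ∀ N L, 1 ≤ L → XXZ.tracePow J h ζ T N L = (Z N (L - 1) : ℂ) := by
    intro N L hL
    obtain ⟨n, rfl⟩ : ∃ n, L = n + 1 := ⟨L - 1, by omega⟩
    exact XXZ.tracePow_eq hsin.ne' J h T N n
  have hlow : ∀ N, 1 ≤ N → (d 0 + d 1) / K ≤ Z N 0 := fun N hN =>
    XXZ.le_periodicPartition_zero hd (XXZ.braid_conserves _ _ d)
      (XXZ.norm_braid_sub_one_le_div hJ hsin hT hN) (XXZ.four_mul_div_le hJ hsin hT hN) (by omega)
      (XXZ.pow_le_exp hJ hsin hT hN)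
  have hmul : ∀ N, 1 ≤ N → ∀ m n, Z N (m + 1 + n) ≤ K ^ 4 * (Z N n * Z N m) ∧
      Z N n * Z N m ≤ K ^ 4 * Z N (m + 1 + n) := fun N hN m n =>
    XXZ.periodicPartition_mul hd (XXZ.braid_conserves _ _ d)
      (XXZ.norm_braid_sub_one_le_div hJ hsin hT hN) (XXZ.four_mul_div_le hJ hsin hT hN) (by omega)
      (XXZ.pow_le_exp hJ hsin hT hN) m n
  have hlow_pos : 0 < (d 0 + d 1) / K := div_pos (add_pos (hd 0) (hd 1)) hK0
  -- A lower bound uniform in `N` keeps the Trotter limit positive, so that its logarithm is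
  -- continuous there.
  have hbound : ∀ n, ∃ c, 0 < c ∧ ∀ N, 1 ≤ N → c ≤ Z N n := by
    intro n
    induction n with
    | zero => exact ⟨_, hlow_pos, hlow⟩
    | succ n ih =>
      obtain ⟨c, hc, hcZ⟩ := ih
      refine ⟨c * ((d 0 + d 1) / K) / K ^ 4, by positivity, fun N hN => ?_⟩
      rw [div_le_iff₀' (by positivity)]
      have h1 := (hmul N hN 0 n).2
      rw [zero_add, add_comm 1 n] at h1
      exact (mul_le_mul (hcZ N hN) (hlow N hN) hlow_pos.le (hc.le.trans (hcZ N hN))).trans h1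
  have hpos : ∀ N, 1 ≤ N → ∀ n, 0 < Z N n := fun N hN n => by
    obtain ⟨c, hc, hcZ⟩ := hbound n
    exact hc.trans_le (hcZ N hN)
  have hlim : ∀ n, ∃ b, 0 < b ∧ Tendsto (fun N => Z N n) atTop (𝓝 b) := by
    intro n
    obtain ⟨b, hb⟩ := XXZ.exists_tendsto_periodicPartition hsin.ne' (J / T * Real.sin ζ) d n
    obtain ⟨c, hc, hcZ⟩ := hbound n
    refine ⟨b, hc.trans_le (ge_of_tendsto hb ?_), hb⟩
    filter_upwards [eventually_ge_atTop 1] with N hN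
    exact hcZ N hN
  choose b hb hbZ using hlim
  have hquasi : ∀ N, 1 ≤ N → ∀ L M, 1 ≤ L → 1 ≤ M →
      |Real.log (Z N (L + M - 1)) - Real.log (Z N (L - 1)) - Real.log (Z N (M - 1))| ≤
        Real.log (K ^ 4) := by
    intro N hN L M hL hM
    obtain ⟨n, rfl⟩ : ∃ n, L = n + 1 := ⟨L - 1, by omega⟩
    obtain ⟨m, rfl⟩ : ∃ m, M = m + 1 := ⟨M - 1, by omega⟩
    rw [show n + 1 + (m + 1) - 1 = m + 1 + n by omega, Nat.add_sub_cancel, Nat.add_sub_cancel]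
    have hn := hpos N hN n
    have hm := hpos N hN m
    have hmn := hpos N hN (m + 1 + n)
    have hK4 : 0 < K ^ 4 := by positivity
    have h1 := Real.log_le_log hmn (hmul N hN m n).1
    have h2 := Real.log_le_log (mul_pos hn hm) (hmul N hN m n).2
    rw [Real.log_mul hK4.ne' (mul_pos hn hm).ne', Real.log_mul hn.ne' hm.ne'] at h1
    rw [Real.log_mul hK4.ne' hmn.ne', Real.log_mul hn.ne' hm.ne'] at h2
    rw [abs_le]
    constructor <;> linarith
  have hlog : ∀ L, 1 ≤ L → Tendsto (fun N => Real.log (Z N (L - 1))) atTop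
      (𝓝 (Real.log (b (L - 1)))) := fun L _ =>
    (hbZ (L - 1)).log (hb (L - 1)).ne'
  obtain ⟨z, φ, h1, h2, h3⟩ := XXZ.exists_tendsto_of_quasiAdditive hquasi hlog
  have htau : ∀ N, 1 ≤ N → ∀ L, 1 ≤ L →
      XXZ.tau J h ζ T N L = ((Real.log (Z N (L - 1)) / L : ℝ) : ℂ) := by
    intro N hN L hL
    rw [XXZ.tau, htr N L hL, ← Complex.ofReal_log (hpos N hN _).le]
    push_cast
    ring
  refine ⟨fun N L hN hL => ?_, fun L => Real.log (b (L - 1)) / L, z, φ, fun L hL => ?_, h1,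
    fun N hN => ?_, h3⟩
  · rw [htr N L hL]
    exact ⟨by simpa using hpos N hN (L - 1), Complex.ofReal_im _⟩
  · refine ((Complex.continuous_ofReal.tendsto _).comp ((hlog L hL).div_const (L : ℝ))).congr' ?_
    filter_upwards [eventually_ge_atTop 1] with N hN
    exact (htau N hN L hL).symm
  · refine ((Complex.continuous_ofReal.tendsto _).comp (h2 N hN)).congr' ?_
    filter_upwards [eventually_ge_atTop 1] with L hL
    exact (htau N hN L hL).symm
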